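/- **Spaces and maps.** Let $X=S_1\vee S_2$ be the wedge, at a vertex $v$, of oriented circles $S_1,S_2$ of lengths $5$ and $3$. Write $S_1=C\,c\,1\,2\,2^r$ and $S_2=A\,B\,b$ as edge-paths starting at $v$ with oriented edges of length $1$; points of each circle are ordered by oriented distance from $v$. Let $f\colon X\to X$ be the map which expands each edge uniformly, with $f(C)=S_2$, $f(c)=S_2^{-1}$, $f(1)=S_1$, $f(2)=S_1$, $f(2^r)=S_1^{-1}$, $f(A)=S_2$, $f(B)=S_1$, $f(b)=S_1^{-1}$. Let $p$ be the common endpoint of $2$ and $2^r$. For $t\in[0,1]$ let $\ell(t)\in 2$ and $r(t)\in 2^r$ be the points at distance $(5-3t)/10$ from $p$, let $I_t=[\ell(t),r(t)]\subset S_1$ be the arc containing $p$, and let $f_t(x)=f(x)$ for $x\notin I_t$ and $f_t(x)=f(\ell(t))$ for $x\in I_t$. **Rotation sets.** For a map $g\colon Z\to Z$ and $\phi\colon Z\to\mathbb R^k$, let $\mathrm{rot}_p(Z,g,\phi)$ be the set of all limits $\lim_{n\to\infty}\frac1n\sum_{i=0}^{n-1}\phi(g^i(z))$, over those $z\in Z$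 for which the limit exists. The universal abelian cover of $X$ is $\tilde X=(\mathbb R\times\mathbb Z)\cup(\mathbb Z\times\mathbb R)$, with $\mathbb R\times\mathbb Z$ covering $S_1$ and $\mathbb Z\times\mathbb R$ covering $S_2$; each $f_t$ has a unique lift $\tilde f_t\colon\tilde X\to\tilde X$ fixing every point of $\mathbb Z^2$. Let $\gamma^t(x)=\tilde f_t(\tilde x)-\tilde x\in\mathbb R^2$, where $\tilde x$ is any lift of $x$, and let $\rho_8(t)=\mathrm{rot}_p(X,f_t,\gamma^t)$. **Digit frequencies.** Let $\sigma$ be the shift on $\Sigma^+=\{0,1,2\}^{\mathbb N}$, ordered lexicographically. For $w\in\Sigma^+$ let $B(w)=\{s\in\Sigma^+:\sigma^r(s)\le w\text{ for all }r\ge0\}$ and $\mathrm{DF}(w)=\mathrm{rot}_p(B(w),\sigma,\kappa)\subset\mathbb R^3$, where $\kappa(s)=e_{s_0}$ and $e_0,e_1,e_2$ is the standard basis. **Kneading sequences.** Let $B'$ and $1'$ be the initial segments of length $4/5$ of the edges $B$ and $1$, and let $C'$ be the segment of $C$ with $f(C')=B'$. Let $W$ be the set of points whose $f$-orbit is contained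 in $B'\cup C'\cup1'\cup2$. For $t\in[0,1]$ let $X_t$ be the set of points whose $f_t$-orbit is disjoint from the interior of $I_t$, and let $Y_t=W\cap X_t$ and $Z_t=Y_t\cap S_1$. The first return map of $f_t|_{Y_t}$ to $Z_t$ is the restriction to $Z_t$ of the map $F$ given by $F=f^2$ on $C'$ and $F=f$ on $1'\cup2$. For $x\in Z_t$ let $h(x)\in\Sigma^+$ be the sequence with $h(x)_r=0,1,2$ according as $F^r(x)$ belongs to $C'$, $1'$, $2$. Let $\mathcal C=\{t\in[0,1]:\ell(t)\in Z_t\}$ and $K(t)=h(\ell(t))$ for $t\in\mathcal C$. **Theorem.** For every $t\in[0,1]$, the maximum $a(t)=\max\{t'\in\mathcal C:t'\le t\}$ exists, and $$\rho_8(t)=\Pi\bigl(\mathrm{DF}(K(a(t)))\bigr),\qquad \Pi(\alpha_0,\alpha_1,\alpha_2)=\left(\frac{\alpha_2}{1+\alpha_0},\frac{\alpha_0}{1+\alpha_0}\right).$$ -/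

import Mathlib

open Filter Topology Set

namespace FigureEight

/-! ### Rotation theory -/

/-- The pointwise rotation set of the dynamical system `g` restricted to the invariant set `S`,
with respect to the observable `φ`: all limits of Birkhoff averages
`(φ z + φ (g z) + ⋯ + φ (g^{r-1} z)) / r` with `z ∈ S`, when they exist. -/
def rotP {Z E : Type*} [AddCommGroup E] [Module ℝ E] [TopologicalSpace E]
    (S : Set Z) (g : Z → Z) (φ : Z → E) : Set E :=
  {v | ∃ z ∈ S, Tendsto (fun r : ℕ => birkhoffAverage ℝ g φ r z) atTop (𝓝 v)}

/-! ### Symbolic β-shifts and digit frequency sets -/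

/-- The one-sided sequence space on the digits `0, 1, 2`. -/
abbrev Seq := ℕ → Fin 3

/-- The shift map. -/
def shift (w : Seq) : Seq := fun n => w (n + 1)

/-- The symbolic β-shift of `w`: the sequences all of whose shifts are lexicographically at most
`w`. -/
def betaShift (w : Seq) : Set Seq := {s | ∀ r : ℕ, toLex (shift^[r] s) ≤ toLex w}

/-- The observable `w ↦ e_{w₀}` with values in the standard basis of `ℝ³`. -/
noncomputable def kappa (w : Seq) : Fin 3 → ℝ := Pi.single (w 0) 1

/-- The digit frequency set of the symbolic β-shift of `w`. -/
noncomputable def DF (w : Seq) : Set (Fin 3 → ℝ) := rotP (betaShift w) shift kappa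

/-- The projective map `(α₀, α₁, α₂) ↦ (α₂ / (1 + α₀), α₀ / (1 + α₀))`. -/
noncomputable def PiMap (α : Fin 3 → ℝ) : ℝ × ℝ := (α 2 / (1 + α 0), α 0 / (1 + α 0))

/-! ### The figure eight space -/

instance fact_pos_five : Fact ((0 : ℝ) < 5) := ⟨by norm_num⟩

instance fact_pos_three : Fact ((0 : ℝ) < 3) := ⟨by norm_num⟩

/-- The wedge of a circle of length `5` and a circle of length `3`, realised as the union of the
two coordinate circles in their product. -/
abbrev X := {q : AddCircle (5 : ℝ) × AddCircle (3 : ℝ) // q.1 = 0 ∨ q.2 = 0}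

/-- Oriented arc length parametrization of the circle `S₁`, starting at the vertex. -/
def i1 (s : ℝ) : X := ⟨((s : AddCircle (5 : ℝ)), 0), Or.inr rfl⟩

/-- Oriented arc length parametrization of the circle `S₂`, starting at the vertex. -/
def i2 (s : ℝ) : X := ⟨(0, (s : AddCircle (3 : ℝ))), Or.inl rfl⟩

/-- The circle `S₁`. -/
def S1 : Set X := range i1

/-- The arc length coordinate in `[0, 5)` of a point of `S₁`. -/
noncomputable def coord1 (x : X) : ℝ := (AddCircle.equivIco (5 : ℝ) 0 x.1.1 : ℝ)

/-- The arc length coordinate in `[0, 3)` of a point of `S₂`. -/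
noncomputable def coord2 (x : X) : ℝ := (AddCircle.equivIco (3 : ℝ) 0 x.1.2 : ℝ)

/-- The map `f` on `S₁`, in terms of the arc length coordinate. The unit edges are, in order,
`C, c, 1, 2, 2ʳ`, with images `S₂, S₂⁻¹, S₁, S₁, S₁⁻¹`. -/
noncomputable def fOne (s : ℝ) : X :=
  if s ≤ 1 then i2 (3 * s)
  else if s ≤ 2 then i2 (3 * (2 - s))
  else if s ≤ 3 then i1 (5 * (s - 2))
  else if s ≤ 4 then i1 (5 * (s - 3))
  else i1 (5 * (5 - s))

/-- The map `f` on `S₂`, in terms of the arc length coordinate. The unit edges are, in order,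
`A, B, b`, with images `S₂, S₁, S₁⁻¹`. -/
noncomputable def fTwo (s : ℝ) : X :=
  if s ≤ 1 then i2 (3 * s)
  else if s ≤ 2 then i1 (5 * (s - 1))
  else i1 (5 * (3 - s))

open Classical in
/-- The map `f : X → X`. -/
noncomputable def f (x : X) : X := if x.1.2 = 0 then fOne (coord1 x) else fTwo (coord2 x)

/-- The coordinate of the point `ℓ(t)` of the edge `2`, at distance `(5 - 3t)/10` before the common
endpoint `p` (of coordinate `4`) of the edges `2` and `2ʳ`. -/
noncomputable def lc (t : ℝ) : ℝ := 4 - (5 - 3 * t) / 10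

/-- The coordinate of the point `r(t)` of the edge `2ʳ`, at distance `(5 - 3t)/10` after `p`. -/
noncomputable def rc (t : ℝ) : ℝ := 4 + (5 - 3 * t) / 10

/-- The point `ℓ(t)`. -/
noncomputable def ell (t : ℝ) : X := i1 (lc t)

open Classical in
/-- The map `f_t`, which is `f` outside the arc `I_t = [ℓ(t), r(t)]` and constant on that arc. -/
noncomputable def fT (t : ℝ) (x : X) : X :=
  if x ∈ i1 '' Icc (lc t) (rc t) then f (ell t) else f x

/-! ### The universal abelian cover and the rotation set of `f_t` -/

/-- The universal abelian cover `(ℝ × ℤ) ∪ (ℤ × ℝ)` of the figure eight. -/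
abbrev Cover := {z : ℝ × ℝ // (∃ n : ℤ, z.2 = n) ∨ (∃ m : ℤ, z.1 = m)}

/-- The covering projection; it takes `ℝ × ℤ` to `S₁` and `ℤ × ℝ` to `S₂`. -/
def proj (z : Cover) : X :=
  ⟨(((5 * z.1.1 : ℝ) : AddCircle (5 : ℝ)), ((3 * z.1.2 : ℝ) : AddCircle (3 : ℝ))), by
    rcases z.2 with ⟨n, hn⟩ | ⟨m, hm⟩
    · right
      exact (AddCircle.coe_eq_zero_iff 3).2 ⟨n, by rw [hn]; simp [mul_comm]⟩
    · left
      exact (AddCircle.coe_eq_zero_iff 5).2 ⟨m, by rw [hm]; simp [mul_comm]⟩⟩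

/-- A point of the integer lattice, as a point of the cover. -/
def lattice (m n : ℤ) : Cover := ⟨((m : ℝ), (n : ℝ)), Or.inl ⟨n, rfl⟩⟩

/-- `F` is a lift of `f_t` to the universal abelian cover which fixes each lattice point. -/
def IsLift (t : ℝ) (F : Cover → Cover) : Prop :=
  Continuous F ∧ (∀ z, proj (F z) = fT t (proj z)) ∧ ∀ m n : ℤ, F (lattice m n) = lattice m n

/-- The lift of `f_t` along the edge path `S₁`, starting from the lattice point `(0, 0)`. -/
noncomputable def e1 (t s : ℝ) : ℝ × ℝ :=
  if s ≤ 1 then (0, s)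
  else if s ≤ 2 then (0, 2 - s)
  else if s ≤ lc t then (s - 2, 0)
  else if s ≤ rc t then (lc t - 2, 0)
  else (6 - s, 0)

/-- The lift of `f_t` along the edge path `S₂`, starting from the lattice point `(0, 0)`. -/
noncomputable def e2 (s : ℝ) : ℝ × ℝ :=
  if s ≤ 1 then (0, s)
  else if s ≤ 2 then (s - 1, 1)
  else (3 - s, 1)

lemma e1_zero (t : ℝ) : e1 t 0 = 0 := by simp [e1]

lemma e2_zero : e2 0 = 0 := by simp [e2]

lemma e1_axis (t s : ℝ) : (e1 t s).1 = 0 ∨ (e1 t s).2 = 0 := by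
  unfold e1; split_ifs <;> simp

lemma e2_axis (s : ℝ) : (e2 s).1 = 0 ∨ (e2 s).2 = 1 := by
  unfold e2; split_ifs <;> simp

/-- The lift of `f_t` which fixes each lattice point. It is determined by this property: see
`isLift_iff`. -/
noncomputable def lift (t : ℝ) (z : Cover) : Cover :=
  ⟨((⌊z.1.1⌋ : ℝ), (⌊z.1.2⌋ : ℝ)) + e1 t (5 * Int.fract z.1.1) + e2 (3 * Int.fract z.1.2), by
    rcases z.2 with ⟨n, hn⟩ | ⟨m, hm⟩
    · rw [hn]
      simp only [Int.fract_intCast, mul_zero, e2_zero, add_zero, Int.floor_intCast]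
      rcases e1_axis t (5 * Int.fract z.1.1) with h | h
      · exact Or.inr ⟨⌊z.1.1⌋, by simp [h]⟩
      · exact Or.inl ⟨n, by simp [h]⟩
    · rw [hm]
      simp only [Int.fract_intCast, mul_zero, e1_zero, add_zero, Int.floor_intCast]
      rcases e2_axis (3 * Int.fract z.1.2) with h | h
      · exact Or.inr ⟨m, by simp [h]⟩
      · exact Or.inl ⟨⌊z.1.2⌋ + 1, by simp [h]⟩⟩

lemma coord1_proj (z : Cover) : coord1 (proj z) = 5 * Int.fract z.1.1 := by
  simp only [coord1, proj, AddCircle.coe_equivIco_mk_apply]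
  rw [mul_div_cancel_left₀ _ (by norm_num), mul_comm]

lemma coord2_proj (z : Cover) : coord2 (proj z) = 3 * Int.fract z.1.2 := by
  simp only [coord2, proj, AddCircle.coe_equivIco_mk_apply]
  rw [mul_div_cancel_left₀ _ (by norm_num), mul_comm]

lemma coe_five_eq (a b : ℝ) (k : ℤ) (h : a = b + 5 * k) :
    (a : AddCircle (5 : ℝ)) = (b : AddCircle (5 : ℝ)) := by
  rw [← sub_eq_zero, ← AddCircle.coe_sub, AddCircle.coe_eq_zero_iff]
  exact ⟨k, by rw [h]; simp [mul_comm]⟩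

lemma coe_three_eq (a b : ℝ) (k : ℤ) (h : a = b + 3 * k) :
    (a : AddCircle (3 : ℝ)) = (b : AddCircle (3 : ℝ)) := by
  rw [← sub_eq_zero, ← AddCircle.coe_sub, AddCircle.coe_eq_zero_iff]
  exact ⟨k, by rw [h]; simp [mul_comm]⟩

lemma X_ext {x y : X} (h1 : x.1.1 = y.1.1) (h2 : x.1.2 = y.1.2) : x = y :=
  Subtype.ext (Prod.ext h1 h2)

lemma proj_snd_eq_zero (z : Cover) : (proj z).1.2 = 0 ↔ ∃ n : ℤ, z.1.2 = n := by
  simp only [proj, AddCircle.coe_eq_zero_iff, zsmul_eq_mul]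
  constructor
  · rintro ⟨n, hn⟩; exact ⟨n, by linarith⟩
  · rintro ⟨n, hn⟩; exact ⟨n, by rw [hn]; ring⟩

lemma coord1_i1 {s : ℝ} (h0 : 0 ≤ s) (h5 : s < 5) : coord1 (i1 s) = s := by
  simp only [coord1, i1, AddCircle.coe_equivIco_mk_apply]
  rw [Int.fract_eq_self.2 ⟨by positivity, by rw [div_lt_one (by norm_num)]; exact h5⟩]
  ring

lemma i1_coord1 (x : X) (h : x.1.2 = 0) : i1 (coord1 x) = x := by
  apply Subtype.ext
  apply Prod.ext
  · exact AddCircle.coe_equivIco (p := (5 : ℝ)) (a := 0)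
  · exact h.symm

lemma mem_arc {a b : ℝ} (ha : 0 ≤ a) (hb : b < 5) (x : X) :
    x ∈ i1 '' Icc a b ↔ x.1.2 = 0 ∧ coord1 x ∈ Icc a b := by
  constructor
  · rintro ⟨s, hs, rfl⟩
    refine ⟨rfl, ?_⟩
    rw [coord1_i1 (ha.trans hs.1) (hs.2.trans_lt hb)]
    exact hs
  · rintro ⟨h, h'⟩
    exact ⟨_, h', i1_coord1 x h⟩

lemma proj_lift {t : ℝ} (ht : t ∈ Icc (0 : ℝ) 1) (z : Cover) :
    proj (lift t z) = fT t (proj z) := by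
  obtain ⟨ht0, ht1⟩ := ht
  have hl : 3 < lc t ∧ lc t < 4 := by unfold lc; constructor <;> linarith
  have hr : 4 < rc t ∧ rc t < 5 := by unfold rc; constructor <;> linarith
  have hell : f (ell t) = i1 (5 * (lc t - 3)) := by
    have h1 : coord1 (ell t) = lc t := coord1_i1 (by linarith) (by linarith)
    have h2 : (ell t).1.2 = 0 := rfl
    rw [f, if_pos h2, h1, fOne, if_neg (by linarith), if_neg (by linarith),
      if_neg (by linarith), if_pos (by linarith)]
  have hmem := mem_arc (by linarith : 0 ≤ lc t) hr.2 (proj z)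
  unfold fT
  rw [hell]
  by_cases hz : ∃ n : ℤ, z.1.2 = n
  · have h2 : (proj z).1.2 = 0 := (proj_snd_eq_zero z).2 hz
    obtain ⟨n, hn⟩ := hz
    have hfr : Int.fract z.1.2 = 0 := by rw [hn]; simp
    have hfl : (⌊z.1.2⌋ : ℝ) = n := by rw [hn]; simp
    have hf : f (proj z) = fOne (coord1 (proj z)) := if_pos h2
    simp only [hmem, h2, true_and, hf, coord1_proj]
    have key : proj (lift t z) =
        ⟨(((5 * (e1 t (5 * Int.fract z.1.1)).1 : ℝ) : AddCircle (5 : ℝ)),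
          ((3 * (e1 t (5 * Int.fract z.1.1)).2 : ℝ) : AddCircle (3 : ℝ))), by
          rcases e1_axis t (5 * Int.fract z.1.1) with h | h <;> simp [h]⟩ := by
      apply Subtype.ext
      apply Prod.ext
      · exact coe_five_eq _ _ ⌊z.1.1⌋ (by simp [lift, hfr, e2_zero]; ring)
      · exact coe_three_eq _ _ n (by simp [lift, hfr, e2_zero, hfl]; ring)
    rw [key]
    set s := 5 * Int.fract z.1.1 with hs
    by_cases hI : s ∈ Icc (lc t) (rc t)
    · have he : e1 t s = (lc t - 2, 0) := by
        unfold e1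
        rw [if_neg (by linarith [hI.1]), if_neg (by linarith [hI.1])]
        by_cases hs' : s ≤ lc t
        · rw [if_pos hs', le_antisymm hs' hI.1]
        · rw [if_neg hs', if_pos hI.2]
      rw [if_pos hI]
      simp only [he]
      exact X_ext (coe_five_eq _ _ 1 (by push_cast; ring)) (by simp [i1])
    · rw [if_neg hI]
      unfold fOne
      by_cases h1 : s ≤ 1
      · simp only [e1, if_pos h1]
        exact X_ext (by simp [i2]) rfl
      by_cases h2 : s ≤ 2
      · simp only [e1, if_neg h1, if_pos h2]
        exact X_ext (by simp [i2]) rfl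
      by_cases h3 : s ≤ 3
      · simp only [e1, if_neg h1, if_neg h2, if_pos h3, if_pos (h3.trans hl.1.le)]
        exact X_ext rfl (by simp [i1])
      by_cases h4 : s ≤ lc t
      · simp only [e1, if_neg h1, if_neg h2, if_neg h3, if_pos h4, if_pos (h4.trans hl.2.le)]
        exact X_ext (coe_five_eq _ _ 1 (by push_cast; ring)) (by simp [i1])
      have h5 : ¬ s ≤ rc t := fun h => hI ⟨(not_le.1 h4).le, h⟩
      have h6 : ¬ s ≤ 4 := fun h => h5 (h.trans hr.1.le)
      simp only [e1, if_neg h1, if_neg h2, if_neg h3, if_neg h4, if_neg h5, if_neg h6]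
      exact X_ext (coe_five_eq _ _ 1 (by push_cast; ring)) (by simp [i1])
  · obtain ⟨m, hm⟩ : ∃ m : ℤ, z.1.1 = m := z.2.resolve_left hz
    have hfr : Int.fract z.1.1 = 0 := by rw [hm]; simp
    have hfl : (⌊z.1.1⌋ : ℝ) = m := by rw [hm]; simp
    have h2 : ¬ (proj z).1.2 = 0 := fun h => hz ((proj_snd_eq_zero z).1 h)
    have hf : f (proj z) = fTwo (coord2 (proj z)) := if_neg h2
    simp only [hmem, h2, false_and, if_false, hf, coord2_proj]
    have key : proj (lift t z) =
        ⟨(((5 * (e2 (3 * Int.fract z.1.2)).1 : ℝ) : AddCircle (5 : ℝ)),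
          ((3 * (e2 (3 * Int.fract z.1.2)).2 : ℝ) : AddCircle (3 : ℝ))), by
          rcases e2_axis (3 * Int.fract z.1.2) with h | h
          · simp [h]
          · right; rw [h]; exact (AddCircle.coe_eq_zero_iff 3).2 ⟨1, by simp⟩⟩ := by
      apply Subtype.ext
      apply Prod.ext
      · exact coe_five_eq _ _ m (by simp [lift, hfr, e1_zero, hfl]; ring)
      · exact coe_three_eq _ _ ⌊z.1.2⌋ (by simp [lift, hfr, e1_zero]; ring)
    rw [key]
    unfold fTwo
    set s := 3 * Int.fract z.1.2 with hs
    by_cases h1 : s ≤ 1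
    · simp only [e2, if_pos h1]
      exact X_ext (by simp [i2]) rfl
    by_cases h2 : s ≤ 2
    · simp only [e2, if_neg h1, if_pos h2]
      exact X_ext rfl (coe_three_eq _ 0 1 (by push_cast; ring))
    simp only [e2, if_neg h1, if_neg h2]
    exact X_ext rfl (coe_three_eq _ 0 1 (by push_cast; ring))

lemma continuous_e1 {t : ℝ} (ht : t ∈ Icc (0 : ℝ) 1) : Continuous (e1 t) := by
  obtain ⟨ht0, ht1⟩ := ht
  have hl : 3 < lc t ∧ lc t < 4 := by unfold lc; constructor <;> linarith
  have hr : 4 < rc t ∧ rc t < 5 := by unfold rc; constructor <;> linarith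
  have hlr : rc t = 8 - lc t := by unfold lc rc; ring
  unfold e1
  refine Continuous.if_le (by fun_prop) ?_ (by fun_prop) (by fun_prop) ?_
  · refine Continuous.if_le (by fun_prop) ?_ (by fun_prop) (by fun_prop) ?_
    · refine Continuous.if_le (by fun_prop) ?_ (by fun_prop) (by fun_prop) ?_
      · refine Continuous.if_le (by fun_prop) (by fun_prop) (by fun_prop) (by fun_prop) ?_
        rintro s rfl
        rw [hlr]; norm_num; ring
      · rintro s rfl
        rw [if_pos (by linarith)]
    · rintro s rfl
      rw [if_pos (by linarith)]; norm_num
  · rintro s rfl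
    norm_num

lemma continuous_e2 : Continuous e2 := by
  unfold e2
  refine Continuous.if_le (by fun_prop) ?_ (by fun_prop) (by fun_prop) ?_
  · refine Continuous.if_le (by fun_prop) (by fun_prop) (by fun_prop) (by fun_prop) ?_
    rintro s rfl
    norm_num
  · rintro s rfl
    norm_num

lemma continuous_lift {t : ℝ} (ht : t ∈ Icc (0 : ℝ) 1) : Continuous (lift t) := by
  have hr : rc t < 5 := by unfold rc; linarith [ht.1]
  have hl : lc t < 5 := by unfold lc; linarith [ht.2]
  have c1 : Continuous (fun x : ℝ => e1 t (5 * Int.fract x) - ((Int.fract x, 0) : ℝ × ℝ)) := by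
    have h : Continuous (fun u : ℝ => e1 t (5 * u) - ((u, 0) : ℝ × ℝ)) :=
      ((continuous_e1 ht).comp (by fun_prop)).sub (by fun_prop)
    refine h.continuousOn.comp_fract'' ?_
    simp only [e1, mul_zero, mul_one]
    rw [if_pos (by norm_num), if_neg (by norm_num), if_neg (by norm_num), if_neg (by linarith),
      if_neg (by linarith)]
    norm_num
  have c2 : Continuous (fun x : ℝ => e2 (3 * Int.fract x) - ((0, Int.fract x) : ℝ × ℝ)) := by
    have h : Continuous (fun u : ℝ => e2 (3 * u) - ((0, u) : ℝ × ℝ)) :=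
      (continuous_e2.comp (by fun_prop)).sub (by fun_prop)
    refine h.continuousOn.comp_fract'' ?_
    norm_num [e2]
  have h : Continuous (fun z : Cover => z.1 +
      (e1 t (5 * Int.fract z.1.1) - ((Int.fract z.1.1, 0) : ℝ × ℝ)) +
      (e2 (3 * Int.fract z.1.2) - ((0, Int.fract z.1.2) : ℝ × ℝ))) :=
    (continuous_subtype_val.add (c1.comp (by fun_prop : Continuous fun z : Cover => z.1.1))).add
      (c2.comp (by fun_prop : Continuous fun z : Cover => z.1.2))
  refine Continuous.subtype_mk (h.congr ?_) _
  intro z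
  apply Prod.ext
  · simp only [Prod.fst_add, Prod.fst_sub]
    linarith [Int.floor_add_fract z.1.1]
  · simp only [Prod.snd_add, Prod.snd_sub]
    linarith [Int.floor_add_fract z.1.2]

lemma isLift_lift {t : ℝ} (ht : t ∈ Icc (0 : ℝ) 1) : IsLift t (lift t) := by
  refine ⟨continuous_lift ht, proj_lift ht, fun m n => ?_⟩
  apply Subtype.ext
  simp [lift, lattice, e1_zero, e2_zero]

lemma int_valued_const (g : ℝ → ℝ) (hg : Continuous g) (hi : ∀ x, ∃ k : ℤ, g x = k) (x y : ℝ) :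
    g x = g y := by
  choose k hk using hi
  have hc : Continuous k := by
    rw [Int.isClosedEmbedding_coe_real.isInducing.continuous_iff]
    exact hg.congr hk
  rw [hk, hk, PreconnectedSpace.constant inferInstance hc (x := x) (y := y)]

lemma proj_eq_iff (z w : Cover) (h : proj z = proj w) :
    (∃ k : ℤ, z.1.1 - w.1.1 = k) ∧ ∃ k : ℤ, z.1.2 - w.1.2 = k := by
  have h1 := congrArg (fun q : X => q.1.1) h
  have h2 := congrArg (fun q : X => q.1.2) h
  simp only [proj] at h1 h2
  rw [← sub_eq_zero, ← AddCircle.coe_sub, AddCircle.coe_eq_zero_iff] at h1 h2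
  obtain ⟨k, hk⟩ := h1
  obtain ⟨j, hj⟩ := h2
  simp only [zsmul_eq_mul] at hk hj
  exact ⟨⟨k, by linarith⟩, ⟨j, by linarith⟩⟩

lemma isLift_unique {t : ℝ} {F G : Cover → Cover} (hF : IsLift t F) (hG : IsLift t G) :
    F = G := by
  have main : ∀ γ : ℝ → Cover, Continuous γ → ∀ x y : ℝ, F (γ y) = G (γ y) →
      F (γ x) = G (γ x) := by
    intro γ hγ x y hy
    have hd := fun s => proj_eq_iff (F (γ s)) (G (γ s)) ((hF.2.1 _).trans (hG.2.1 _).symm)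
    have cF : Continuous fun s => (F (γ s)).1 := continuous_subtype_val.comp (hF.1.comp hγ)
    have cG : Continuous fun s => (G (γ s)).1 := continuous_subtype_val.comp (hG.1.comp hγ)
    have e1 := int_valued_const (fun s => (F (γ s)).1.1 - (G (γ s)).1.1)
      (cF.fst.sub cG.fst) (fun s => (hd s).1) x y
    have e2 := int_valued_const (fun s => (F (γ s)).1.2 - (G (γ s)).1.2)
      (cF.snd.sub cG.snd) (fun s => (hd s).2) x y
    simp only [hy, sub_self] at e1 e2
    exact Subtype.ext (Prod.ext (sub_eq_zero.1 e1) (sub_eq_zero.1 e2))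
  have hlat : ∀ m n : ℤ, F (lattice m n) = G (lattice m n) := fun m n => by
    rw [hF.2.2, hG.2.2]
  funext z
  rcases z with ⟨⟨a, b⟩, ⟨n, hn⟩ | ⟨m, hm⟩⟩
  · obtain rfl : b = n := hn
    exact main (fun s => ⟨(s, (n : ℝ)), Or.inl ⟨n, rfl⟩⟩) (by fun_prop) a ((0 : ℤ) : ℝ) (hlat 0 n)
  · obtain rfl : a = m := hm
    exact main (fun s => ⟨((m : ℝ), s), Or.inr ⟨m, rfl⟩⟩) (by fun_prop) b ((0 : ℤ) : ℝ) (hlat m 0)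

/-- `lift t` is the unique lift of `f_t` which fixes each lattice point. -/
theorem isLift_iff {t : ℝ} (ht : t ∈ Icc (0 : ℝ) 1) (F : Cover → Cover) :
    IsLift t F ↔ F = lift t :=
  ⟨fun h => isLift_unique h (isLift_lift ht), fun h => h ▸ isLift_lift ht⟩

/-- A choice of lift to the cover of each point of `X`. -/
noncomputable def sec (x : X) : Cover :=
  ⟨(coord1 x / 5, coord2 x / 3), by
    rcases x.2 with h | h
    · refine Or.inr ⟨0, ?_⟩
      rw [coord1, h, ← AddCircle.coe_zero, AddCircle.coe_equivIco_mk_apply]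
      simp
    · refine Or.inl ⟨0, ?_⟩
      rw [coord2, h, ← AddCircle.coe_zero, AddCircle.coe_equivIco_mk_apply]
      simp⟩

lemma proj_sec (x : X) : proj (sec x) = x := by
  apply Subtype.ext
  apply Prod.ext
  · simp only [proj, sec, mul_div_cancel₀ _ (by norm_num : (5 : ℝ) ≠ 0)]
    exact AddCircle.coe_equivIco (p := (5 : ℝ)) (a := 0)
  · simp only [proj, sec, mul_div_cancel₀ _ (by norm_num : (3 : ℝ) ≠ 0)]
    exact AddCircle.coe_equivIco (p := (3 : ℝ)) (a := 0)

/-- The displacement `γ^t(x) = f̃_t(x̃) - x̃`, where `x̃` is a lift of `x`. By `gamma_proj` it does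
not depend on the lift. -/
noncomputable def gamma (t : ℝ) (x : X) : ℝ × ℝ := (lift t (sec x)).1 - (sec x).1

lemma gamma_proj (t : ℝ) (z : Cover) : gamma t (proj z) = (lift t z).1 - z.1 := by
  simp only [gamma, sec, lift, coord1_proj, coord2_proj]
  have h : ∀ a b : ℝ, b ≠ 0 → b * a / b = a := fun a b hb => by field_simp
  rw [h _ 5 (by norm_num), h _ 3 (by norm_num)]
  simp only [Int.fract_fract, Int.floor_fract]
  apply Prod.ext
  · simp only [Prod.fst_add, Prod.fst_sub]
    push_cast
    linarith [Int.floor_add_fract z.1.1]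
  · simp only [Prod.snd_add, Prod.snd_sub]
    push_cast
    linarith [Int.floor_add_fract z.1.2]

/-- The rotation set `ρ₈(t)` of `f_t`. -/
noncomputable def rho8 (t : ℝ) : Set (ℝ × ℝ) := rotP univ (fT t) (gamma t)

/-! ### Invariant subsets, the return map, and the kneading sequence -/

/-- `B'`: the initial segment of length `4/5` of the edge `B`. -/
def edgeB' : Set X := i2 '' Icc 1 (9 / 5)

/-- `C'`: the segment of the edge `C` which `f` takes onto `B'`. -/
def edgeC' : Set X := i1 '' Icc (1 / 3) (3 / 5)

/-- `1'`: the initial segment of length `4/5` of the edge `1`. -/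
def edgeOne' : Set X := i1 '' Icc 2 (14 / 5)

/-- The edge `2`. -/
def edgeTwo : Set X := i1 '' Icc 3 4

/-- `W`: the points whose `f`-orbits are contained in `B' ∪ C' ∪ 1' ∪ 2`. -/
def W : Set X := {x | ∀ r : ℕ, f^[r] x ∈ edgeB' ∪ edgeC' ∪ edgeOne' ∪ edgeTwo}

/-- `X_t`: the points whose `f_t`-orbits avoid the interior of the arc `I_t`. -/
def XT (t : ℝ) : Set X := {x | ∀ r : ℕ, (fT t)^[r] x ∉ i1 '' Ioo (lc t) (rc t)}

/-- `Z_t = Y_t ∩ S₁`, where `Y_t = W ∩ X_t`. -/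
def ZT (t : ℝ) : Set X := W ∩ XT t ∩ S1

open Classical in
/-- The map `F`, equal to `f²` on `C'` and to `f` on `1' ∪ 2`. On `Z_t` it is the first return
map `R_t` of `f_t` on `Y_t`. -/
noncomputable def F (x : X) : X := if x ∈ edgeC' then f (f x) else f x

open Classical in
/-- The itinerary of a point `x` under `F`: the digit is `0`, `1` or `2` according as the point of
the `F`-orbit is in `C'`, `1'` or `2`. It is meant for `x` in some `Z_t`. -/
noncomputable def itinerary (x : X) : Seq := fun r =>
  if F^[r] x ∈ edgeC' then 0 else if F^[r] x ∈ edgeOne' then 1 else 2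

/-- The parameters `t ∈ [0, 1]` for which `ℓ(t) ∈ Z_t`. -/
def paramSet : Set ℝ := {t | t ∈ Icc (0 : ℝ) 1 ∧ ell t ∈ ZT t}

/-- `a(t) = max {t' ∈ paramSet : t' ≤ t}`. -/
noncomputable def a (t : ℝ) : ℝ := sSup {t' | t' ∈ paramSet ∧ t' ≤ t}

/-- The kneading sequence of a parameter in `paramSet`. -/
noncomputable def K (t : ℝ) : Seq := itinerary (ell t)

end FigureEight

/-!
The orbit of a point of `S₁` is coded by digits: `0` for the edge `C`, followed by a
passage through `B`, which takes two units of time and moves the lift by `(0, 1)`; `1` for the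
edge `1`, which takes one unit of time and does not move; `2` for the edge `2`, which takes one unit
of time and moves by `(1, 0)`. So digit frequencies `α` correspond to the rotation vector
`(α₂, α₀) / (1 + α₀)`, which is `PiMap α`; bounded errors in the counts do not matter
(`tendsto_displacement_of_frequency` and `tendsto_frequency_of_displacement`).

The inverse branches of `F` over `C'`, `1'` and `2` are increasing contractions with disjoint images
that are ordered like the digits, so each digit sequence `s` is the itinerary of exactly one point,
of coordinate `point s`, and `point` is a continuous order embedding. Hence `paramSet` corresponds to
the sequences that are at least all of their shifts and at least `21^∞`, and it is compact; thus the
maximum `a t` exists. A sequence all of whose shifts code points to the left of `ℓ(t)` is in the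
`β`-shift of `K (a t)`: take the maximum of its orbit closure (`mem_betaShift_of_point_le`).

For the inclusion `⊇`, the orbit of the point with itinerary `s` in the `β`-shift does not enter the
plateau, so it is also an orbit of `f_t` (`orbit_point`).

For the inclusion `⊆`, an orbit that reaches the vertex has rotation vector `0`, like `1^∞`. Any
other orbit is coded by folding `c`, `2ʳ` and `b` onto `C`, `2` and `B`. Folding, and the plateau,
only lower the coordinates on `S₁`, so the code of the future of a point is at most the point,
as long as the orbit does not visit the edge `A`. A unit of time spent in `A` moves nothing, like
a digit `1`, but `C A … A B` comes from points of `C` to the left of `C'`, and the code `01…1` would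
be too large. The remedy (`rearrange`) is to move one such digit: if a visit to `A` follows a `2`
before the next `2` does, the `1` of the first unit of time in `A` is put in front of that `2`. All
sequences that contain this place become smaller than the orbit allows, and the delayed `2` is
followed by `1…10`, so that the sequence from it on is below `21^∞`, and thus below `ℓ(t)`. As only
one digit at a time is out of place, the digit counts change by at most `1`.
-/

namespace FigureEight

/-! ### Coding of points by digit sequences -/

/-- The left endpoints `1/3, 2, 3` of the segments `C'`, `1'` and `2` of `S₁`. -/
noncomputable def branchOffset : Fin 3 → ℝ := ![1 / 3, 2, 3]

/-- The contraction factors of the inverse branches of `F` over `C'`, `1'` and `2`. -/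
noncomputable def branchSlope : Fin 3 → ℝ := ![1 / 15, 1 / 5, 1 / 5]

/-- The inverse branch of `F` with values in `C'`, `1'` or `2` according to the digit `d`, in
terms of the arc length coordinate on `S₁`. -/
noncomputable def branch (d : Fin 3) (y : ℝ) : ℝ := branchOffset d + branchSlope d * y

/-- The arc length coordinate of the point of `S₁` whose itinerary under `F` is `s`. -/
noncomputable def point (s : Seq) : ℝ :=
  ∑' n, branchOffset (s n) * ∏ i ∈ Finset.range n, branchSlope (s i)

lemma branch_zero (y : ℝ) : branch 0 y = (1 + y / 5) / 3 := by
  simp [branch, branchOffset, branchSlope]; ring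

lemma branch_one (y : ℝ) : branch 1 y = 2 + y / 5 := by
  simp [branch, branchOffset, branchSlope]; ring

lemma branch_two (y : ℝ) : branch 2 y = 3 + y / 5 := by
  simp [branch, branchOffset, branchSlope]; ring

lemma branchOffset_mem (d : Fin 3) : branchOffset d ∈ Icc (0 : ℝ) 3 := by
  fin_cases d <;> norm_num [branchOffset]

lemma branchSlope_mem (d : Fin 3) : branchSlope d ∈ Ioc (0 : ℝ) (1 / 5) := by
  fin_cases d <;> norm_num [branchSlope]

lemma branch_mono (d : Fin 3) : Monotone (branch d) := fun x y h => by
  have := (branchSlope_mem d).1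
  unfold branch
  gcongr

/-- The ranges of the three inverse branches are disjoint and ordered like the digits. -/
lemma branch_lt_branch {d e : Fin 3} (h : d < e) {x y : ℝ} (hx : x ≤ 15 / 4) (hy : 0 ≤ y) :
    branch d x < branch e y := by
  fin_cases d <;> fin_cases e <;> simp [branch, branchOffset, branchSlope] at h ⊢ <;> linarith

lemma point_term_mem (s : Seq) (n : ℕ) :
    branchOffset (s n) * ∏ i ∈ Finset.range n, branchSlope (s i) ∈ Icc 0 (3 * (1 / 5 : ℝ) ^ n) := by
  have h1 : 0 ≤ ∏ i ∈ Finset.range n, branchSlope (s i) :=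
    Finset.prod_nonneg fun i _ => (branchSlope_mem _).1.le
  have h2 : ∏ i ∈ Finset.range n, branchSlope (s i) ≤ (1 / 5 : ℝ) ^ n := by
    simpa using Finset.prod_le_prod (s := Finset.range n) (g := fun _ => (1 / 5 : ℝ))
      (fun i _ => (branchSlope_mem (s i)).1.le) fun i _ => (branchSlope_mem (s i)).2
  have h3 := branchOffset_mem (s n)
  exact ⟨mul_nonneg h3.1 h1, mul_le_mul h3.2 h2 h1 (by norm_num)⟩

lemma summable_bound : Summable fun n : ℕ => 3 * (1 / 5 : ℝ) ^ n :=
  (summable_geometric_of_lt_one (by norm_num) (by norm_num)).mul_left 3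

lemma summable_point (s : Seq) :
    Summable fun n => branchOffset (s n) * ∏ i ∈ Finset.range n, branchSlope (s i) :=
  Summable.of_nonneg_of_le (fun n => (point_term_mem s n).1) (fun n => (point_term_mem s n).2)
    summable_bound

lemma point_eq (s : Seq) : point s = branch (s 0) (point (shift s)) := by
  rw [point, (summable_point s).tsum_eq_zero_add, branch, point, ← tsum_mul_left]
  congr 1
  · simp
  · congr 1
    funext n
    rw [Finset.prod_range_succ']
    simp only [shift]
    ring

lemma point_nonneg (s : Seq) : 0 ≤ point s := tsum_nonneg fun n => (point_term_mem s n).1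

lemma point_le (s : Seq) : point s ≤ 15 / 4 := by
  have h := (summable_point s).tsum_le_tsum (fun n => (point_term_mem s n).2) summable_bound
  rw [tsum_mul_left, tsum_geometric_of_lt_one (by norm_num) (by norm_num)] at h
  unfold point
  linarith

lemma continuous_point : Continuous point := by
  refine continuous_tsum (fun n => ?_) summable_bound fun n s => ?_
  · have h : ∀ (g : Fin 3 → ℝ) (i : ℕ), Continuous fun s : Seq => g (s i) := fun g i =>
      continuous_of_discreteTopology.comp (continuous_apply i)
    exact (h _ _).mul (continuous_finsetProd _ fun i _ => h _ _)
  · rw [Real.norm_of_nonneg (point_term_mem s n).1]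
    exact (point_term_mem s n).2

lemma continuous_shift : Continuous shift := continuous_pi fun n => continuous_apply (n + 1)

lemma shift_iterate (s : Seq) (r n : ℕ) : shift^[r] s n = s (n + r) := by
  induction r generalizing s with
  | zero => rfl
  | succ r ih => rw [Function.iterate_succ_apply, ih, shift, add_assoc]

lemma point_iterate (s : Seq) (r : ℕ) :
    point (shift^[r] s) = branch (s r) (point (shift^[r + 1] s)) := by
  rw [point_eq, shift_iterate, Function.iterate_succ_apply', zero_add]

lemma point_lt_of_agree (n : ℕ) {s w : Seq} (h : ∀ i < n, s i = w i) (hn : s n < w n) :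
    point s < point w := by
  induction n generalizing s w with
  | zero =>
    rw [point_eq s, point_eq w]
    exact branch_lt_branch hn (point_le _) (point_nonneg _)
  | succ n ih =>
    rw [point_eq s, point_eq w, h 0 n.succ_pos]
    have h1 := ih (s := shift s) (w := shift w) (fun i hi => h (i + 1) (by omega)) hn
    have h2 := (branchSlope_mem (w 0)).1
    unfold branch
    gcongr

/-- The coding `s ↦ point s` is an order embedding for the lexicographic order. -/
lemma point_le_point {s w : Seq} : point s ≤ point w ↔ toLex s ≤ toLex w := by
  have h : StrictMono fun u : Lex Seq => point (ofLex u) := by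
    intro u v ⟨n, h1, h2⟩
    exact point_lt_of_agree n h1 h2
  exact h.le_iff_le (a := toLex s) (b := toLex w)

lemma le_of_forall_le_add_pow {x y c : ℝ} (h : ∀ d : ℕ, x ≤ y + c * (1 / 5) ^ d) : x ≤ y := by
  have : Tendsto (fun d : ℕ => y + c * (1 / 5 : ℝ) ^ d) atTop (𝓝 (y + c * 0)) :=
    ((tendsto_pow_atTop_nhds_zero_of_lt_one (by norm_num) (by norm_num)).const_mul c).const_add y
  simpa using ge_of_tendsto' this h

lemma branch_add_le (d : Fin 3) (x : ℝ) {e : ℝ} (he : 0 ≤ e) :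
    branch d (x + e) ≤ branch d x + e * (1 / 5) := by
  have := (branchSlope_mem d).2
  unfold branch
  nlinarith

/-- The constant sequence `1^∞`. -/
def ones : Seq := fun _ => 1

lemma point_ones : point ones = 5 / 2 := by
  have h := point_eq ones
  rw [show ones 0 = 1 from rfl, branch_one, show shift ones = ones from rfl] at h
  linarith

lemma point_mem_of_zero {s : Seq} (h : s 0 = 0) :
    point s = (1 + point (shift s) / 5) / 3 ∧ 1 / 3 < point s ∧ point s < 3 / 5 := by
  have h1 := point_eq s
  rw [h, branch_zero] at h1
  have h2 := point_le (shift s)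
  have h3 : 0 < point (shift s) := by
    have h4 := point_nonneg (shift (shift s))
    rw [point_eq]
    generalize (shift s) 0 = d
    fin_cases d <;> simp [branch, branchOffset, branchSlope] <;> linarith
  exact ⟨h1, by linarith, by linarith⟩

lemma point_pos (s : Seq) : 0 < point s := by
  have h4 := point_nonneg (shift s)
  rw [point_eq]
  generalize s 0 = d
  fin_cases d <;> simp [branch, branchOffset, branchSlope] <;> linarith

lemma point_mem_of_one {s : Seq} (h : s 0 = 1) :
    point s = 2 + point (shift s) / 5 ∧ 2 < point s ∧ point s < 14 / 5 := by
  have h1 := point_eq s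
  rw [h, branch_one] at h1
  have h2 := point_le (shift s)
  have h3 := point_pos (shift s)
  exact ⟨h1, by linarith, by linarith⟩

lemma point_mem_of_two {s : Seq} (h : s 0 = 2) :
    point s = 3 + point (shift s) / 5 ∧ 3 < point s ∧ point s < 4 := by
  have h1 := point_eq s
  rw [h, branch_two] at h1
  have h2 := point_le (shift s)
  have h3 := point_pos (shift s)
  exact ⟨h1, by linarith, by linarith⟩

lemma digit_cases (d : Fin 3) : d = 0 ∨ d = 1 ∨ d = 2 := by
  fin_cases d <;> simp

/-! ### The maps `f` and `f_t` in arc length coordinates -/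

lemma i1_five : i1 5 = i1 0 := X_ext (coe_five_eq _ _ 1 (by norm_num)) rfl

lemma i2_zero : i2 0 = i1 0 := X_ext (by simp [i1, i2]) (by simp [i1, i2])

lemma i2_three : i2 3 = i1 0 :=
  X_ext (by simp [i1, i2]) (by simp [i1, i2])

lemma coord2_i2 {q : ℝ} (h0 : 0 ≤ q) (h3 : q < 3) : coord2 (i2 q) = q := by
  simp only [coord2, i2, AddCircle.coe_equivIco_mk_apply]
  rw [Int.fract_eq_self.2 ⟨by positivity, by rw [div_lt_one (by norm_num)]; exact h3⟩]
  ring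

lemma i2_coord2 (x : X) (h : x.1.1 = 0) : i2 (coord2 x) = x :=
  X_ext h.symm (AddCircle.coe_equivIco (p := (3 : ℝ)) (a := 0))

lemma coord1_mem (x : X) : coord1 x ∈ Ico (0 : ℝ) 5 := by
  simpa [coord1] using (AddCircle.equivIco (5 : ℝ) 0 x.1.1).2

lemma coord2_mem (x : X) : coord2 x ∈ Ico (0 : ℝ) 3 := by
  simpa [coord2] using (AddCircle.equivIco (3 : ℝ) 0 x.1.2).2

lemma i1_snd (z : ℝ) : (i1 z).1.2 = 0 := rfl

lemma i2_snd_ne {q : ℝ} (h0 : 0 < q) (h3 : q < 3) : (i2 q).1.2 ≠ 0 := by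
  intro h
  have h1 : i2 q = i1 0 := X_ext (by simp [i1, i2]) h
  have h2 := congrArg coord2 h1
  rw [coord2_i2 h0.le h3, ← i2_zero, coord2_i2 le_rfl (by norm_num)] at h2
  exact h0.ne' h2

lemma f_i1 {z : ℝ} (h0 : 0 ≤ z) (h5 : z < 5) : f (i1 z) = fOne z := by
  rw [f, if_pos (i1_snd z), coord1_i1 h0 h5]

lemma f_i2 {q : ℝ} (h0 : 0 < q) (h3 : q < 3) : f (i2 q) = fTwo q := by
  rw [f, if_neg (i2_snd_ne h0 h3), coord2_i2 h0.le h3]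

lemma i1_mem_arc {a b z : ℝ} (ha : 0 ≤ a) (hb : b < 5) (h0 : 0 ≤ z) (h5 : z < 5) :
    i1 z ∈ i1 '' Icc a b ↔ z ∈ Icc a b := by
  rw [mem_arc ha hb, coord1_i1 h0 h5]
  exact and_iff_right rfl

lemma i2_notMem_arc {a b q : ℝ} (ha : 0 ≤ a) (hb : b < 5) (h0 : 0 < q) (h3 : q < 3) :
    i2 q ∉ i1 '' Icc a b := by
  rw [mem_arc ha hb]
  exact fun h => i2_snd_ne h0 h3 h.1

lemma lc_bounds {t : ℝ} (ht : t ∈ Icc (0 : ℝ) 1) : lc t ∈ Icc (7 / 2 : ℝ) (19 / 5) := by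
  obtain ⟨h0, h1⟩ := ht
  unfold lc
  constructor <;> linarith

lemma rc_eq (t : ℝ) : rc t = 8 - lc t := by unfold rc lc; ring

/-! ### Points with itineraries -/

lemma vertex_notMem_W : i1 0 ∉ W := by
  intro h
  rcases h 0 with ((⟨q, hq, h⟩ | h) | h) | h
  · exact i2_snd_ne (by linarith [hq.1]) (by linarith [hq.2])
      ((congrArg (fun x : X => x.1.2) h).trans (i1_snd 0))
  all_goals
    have h := (i1_mem_arc (by norm_num) (by norm_num) le_rfl (by norm_num)).1 h
    norm_num at h

lemma f_mem_W {x : X} (h : x ∈ W) : f x ∈ W := fun r => h (r + 1)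

lemma edge_of_mem_W {x : X} (h : x ∈ W) (hx : x.1.2 = 0) :
    coord1 x ∈ Icc (1 / 3 : ℝ) (3 / 5) ∨ coord1 x ∈ Icc (2 : ℝ) (14 / 5) ∨
      coord1 x ∈ Icc (3 : ℝ) 4 := by
  rcases h 0 with ((⟨q, hq, h⟩ | h) | h) | h
  · exact absurd ((congrArg (fun x : X => x.1.2) h).trans hx)
      (i2_snd_ne (by linarith [hq.1]) (by linarith [hq.2]))
  all_goals
    have h := ((mem_arc (by norm_num) (by norm_num) _).1 h).2
    tauto

open Classical in
/-- On `W ∩ S₁` the map `F` is inverted by the branch named by the leading itinerary digit. -/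
lemma coord1_eq_branch {x : X} (h : x ∈ W) (hx : x.1.2 = 0) :
    F x ∈ W ∧ (F x).1.2 = 0 ∧ coord1 x = branch (itinerary x 0) (coord1 (F x)) := by
  have key : ∀ z : ℝ, z ∈ Icc (1 / 3 : ℝ) (3 / 5) ∨ z ∈ Icc (2 : ℝ) (14 / 5) ∨
      z ∈ Icc (3 : ℝ) 4 → i1 z ∈ W → F (i1 z) ∈ W ∧ (F (i1 z)).1.2 = 0 ∧
        coord1 (i1 z) = branch (itinerary (i1 z) 0) (coord1 (F (i1 z))) := by
    intro z hz hW
    have hf := f_mem_W hW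
    have hff := f_mem_W hf
    have i0 : itinerary (i1 z) 0 =
      if i1 z ∈ edgeC' then 0 else if i1 z ∈ edgeOne' then 1 else 2 := rfl
    have z0 : 0 ≤ z := by rcases hz with h | h | h <;> linarith [h.1]
    have z5 : z < 5 := by rcases hz with h | h | h <;> linarith [h.2]
    have hC : i1 z ∈ edgeC' ↔ z ∈ Icc (1 / 3 : ℝ) (3 / 5) :=
      i1_mem_arc (by norm_num) (by norm_num) z0 z5
    have h1 : i1 z ∈ edgeOne' ↔ z ∈ Icc (2 : ℝ) (14 / 5) :=
      i1_mem_arc (by norm_num) (by norm_num) z0 z5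
    rw [i0, F]
    simp only [hC, h1, coord1_i1 z0 z5]
    rw [f_i1 z0 z5] at hf hff ⊢
    rcases hz with h | h | h
    · simp only [if_pos h]
      have e1 : fOne z = i2 (3 * z) := by rw [fOne, if_pos (by linarith [h.2])]
      rw [e1] at hff ⊢
      rw [f_i2 (by linarith [h.1]) (by linarith [h.2])] at hff ⊢
      rcases h.1.eq_or_lt with h' | h'
      · refine absurd ?_ vertex_notMem_W
        rwa [fTwo, if_pos (by linarith), ← h', show (3 : ℝ) * (3 * (1 / 3)) = 3 by norm_num,
          i2_three] at hff
      · have e2 : fTwo (3 * z) = i1 (5 * (3 * z - 1)) := by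
          rw [fTwo, if_neg (by linarith), if_pos (by linarith [h.2])]
        rw [e2] at hff ⊢
        refine ⟨hff, rfl, ?_⟩
        rw [coord1_i1 (by linarith) (by linarith [h.2]), branch_zero]
        ring
    · have n1 : ¬ z ∈ Icc (1 / 3 : ℝ) (3 / 5) := fun h' => by linarith [h.1, h'.2]
      simp only [if_neg n1, if_pos h]
      rcases h.1.eq_or_lt with h' | h'
      · refine absurd ?_ vertex_notMem_W
        rwa [fOne, if_neg (by linarith), if_pos (by linarith), ← h',
          show (3 : ℝ) * (2 - 2) = 0 by norm_num, i2_zero] at hf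
      · have e2 : fOne z = i1 (5 * (z - 2)) := by
          rw [fOne, if_neg (by linarith), if_neg (by linarith), if_pos (by linarith [h.2])]
        rw [e2] at hf ⊢
        refine ⟨hf, rfl, ?_⟩
        rw [coord1_i1 (by linarith) (by linarith [h.2]), branch_one]
        ring
    · have n1 : ¬ z ∈ Icc (1 / 3 : ℝ) (3 / 5) := fun h' => by linarith [h.1, h'.2]
      have n2 : ¬ z ∈ Icc (2 : ℝ) (14 / 5) := fun h' => by linarith [h.1, h'.2]
      simp only [if_neg n1, if_neg n2]
      rcases h.1.eq_or_lt with h' | h'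
      · refine absurd ?_ vertex_notMem_W
        rwa [fOne, if_neg (by linarith), if_neg (by linarith), if_pos (by linarith), ← h',
          show (5 : ℝ) * (3 - 2) = 5 by norm_num, i1_five] at hf
      have e2 : fOne z = i1 (5 * (z - 3)) := by
        rw [fOne, if_neg (by linarith), if_neg (by linarith), if_neg (by linarith),
          if_pos (by linarith [h.2])]
      rw [e2] at hf ⊢
      rcases h.2.eq_or_lt with h'' | h''
      · refine absurd ?_ vertex_notMem_W
        rwa [h'', show (5 : ℝ) * (4 - 3) = 5 by norm_num, i1_five] at hf
      refine ⟨hf, rfl, ?_⟩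
      rw [coord1_i1 (by linarith) (by linarith), branch_two]
      ring
  have h1 := key (coord1 x) (edge_of_mem_W h hx)
  rw [i1_coord1 x hx] at h1
  exact h1 h

lemma shift_itinerary (x : X) : shift (itinerary x) = itinerary (F x) := rfl

/-- A point of `W ∩ S₁` is determined by its itinerary. -/
lemma coord1_eq_point {x : X} (h : x ∈ W) (hx : x.1.2 = 0) :
    coord1 x = point (itinerary x) := by
  have key : ∀ d : ℕ, ∀ x ∈ W, x.1.2 = 0 →
      |coord1 x - point (itinerary x)| ≤ 0 + 5 * (1 / 5 : ℝ) ^ d := by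
    intro d
    induction d with
    | zero =>
      intro x _ _
      have h1 := coord1_mem x
      have h2 := point_le (itinerary x)
      have h3 := point_nonneg (itinerary x)
      rw [abs_le]
      constructor <;> linarith [h1.1, h1.2]
    | succ d ih =>
      intro x h hx
      obtain ⟨h1, h2, h3⟩ := coord1_eq_branch h hx
      have h4 := ih _ h1 h2
      have h5 := branchSlope_mem (itinerary x 0)
      rw [h3, point_eq, shift_itinerary, branch, branch, add_sub_add_left_eq_sub, ← mul_sub,
        abs_mul, abs_of_pos h5.1, pow_succ]
      have := mul_le_mul h5.2 h4 (abs_nonneg _) (by norm_num)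
      linarith
  have h0 := le_of_forall_le_add_pow fun d => key d x h hx
  exact sub_eq_zero.1 (abs_eq_zero.1 (le_antisymm h0 (abs_nonneg _)))

lemma fOne_point_zero {s : Seq} (h : s 0 = 0) :
    fOne (point s) = i2 (3 * point s) ∧ fTwo (3 * point s) = i1 (point (shift s)) := by
  obtain ⟨h1, h2, h3⟩ := point_mem_of_zero h
  rw [fOne, fTwo, if_pos (by linarith), if_neg (by linarith), if_pos (by linarith)]
  refine ⟨rfl, ?_⟩
  congr 1
  linarith

lemma fOne_point {s : Seq} (h : s 0 ≠ 0) : fOne (point s) = i1 (point (shift s)) := by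
  rcases digit_cases (s 0) with h0 | h0 | h0
  · exact absurd h0 h
  · obtain ⟨h1, h2, h3⟩ := point_mem_of_one h0
    rw [fOne, if_neg (by linarith), if_neg (by linarith), if_pos (by linarith)]
    congr 1
    linarith
  · obtain ⟨h1, h2, h3⟩ := point_mem_of_two h0
    rw [fOne, if_neg (by linarith), if_neg (by linarith), if_neg (by linarith),
      if_pos (by linarith)]
    congr 1
    linarith

lemma f_point (s : Seq) : f (i1 (point s)) = fOne (point s) :=
  f_i1 (point_nonneg s) (by linarith [point_le s])

lemma f_f_point {s : Seq} (h : s 0 = 0) : f (f (i1 (point s))) = i1 (point (shift s)) := by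
  obtain ⟨-, h2, h3⟩ := point_mem_of_zero h
  rw [f_point, (fOne_point_zero h).1, f_i2 (by linarith) (by linarith), (fOne_point_zero h).2]

lemma point_mem_edgeC' (s : Seq) : i1 (point s) ∈ edgeC' ↔ s 0 = 0 := by
  rw [edgeC', i1_mem_arc (by norm_num) (by norm_num) (point_nonneg s) (by linarith [point_le s])]
  rcases digit_cases (s 0) with h0 | h0 | h0
  · obtain ⟨h1, h2, h3⟩ := point_mem_of_zero h0
    exact iff_of_true ⟨h2.le, h3.le⟩ h0
  · obtain ⟨h1, h2, h3⟩ := point_mem_of_one h0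
    exact iff_of_false (fun h => by linarith [h.2]) (by simp [h0])
  · obtain ⟨h1, h2, h3⟩ := point_mem_of_two h0
    exact iff_of_false (fun h => by linarith [h.2]) (by simp [h0])

lemma point_mem_edgeOne' (s : Seq) : i1 (point s) ∈ edgeOne' ↔ s 0 = 1 := by
  rw [edgeOne', i1_mem_arc (by norm_num) (by norm_num) (point_nonneg s) (by linarith [point_le s])]
  rcases digit_cases (s 0) with h0 | h0 | h0
  · obtain ⟨h1, h2, h3⟩ := point_mem_of_zero h0
    exact iff_of_false (fun h => by linarith [h.1]) (by simp [h0])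
  · obtain ⟨h1, h2, h3⟩ := point_mem_of_one h0
    exact iff_of_true ⟨h2.le, h3.le⟩ h0
  · obtain ⟨h1, h2, h3⟩ := point_mem_of_two h0
    exact iff_of_false (fun h => by linarith [h.2]) (by simp [h0])

lemma point_mem_edgeTwo {s : Seq} (h0 : s 0 = 2) : i1 (point s) ∈ edgeTwo := by
  obtain ⟨h1, h2, h3⟩ := point_mem_of_two h0
  exact ⟨_, ⟨h2.le, h3.le⟩, rfl⟩

lemma F_point (s : Seq) : F (i1 (point s)) = i1 (point (shift s)) := by
  by_cases h : s 0 = 0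
  · rw [F, if_pos ((point_mem_edgeC' s).2 h), f_f_point h]
  · rw [F, if_neg (mt (point_mem_edgeC' s).1 h), f_point, fOne_point h]

lemma itinerary_point (s : Seq) : itinerary (i1 (point s)) = s := by
  have hF : ∀ r, F^[r] (i1 (point s)) = i1 (point (shift^[r] s)) := by
    intro r
    induction r with
    | zero => rfl
    | succ r ih => rw [Function.iterate_succ_apply', ih, F_point, Function.iterate_succ_apply']
  funext r
  simp only [itinerary, hF, point_mem_edgeC', point_mem_edgeOne', shift_iterate, zero_add]
  rcases digit_cases (s r) with h0 | h0 | h0 <;> simp [h0]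

lemma point_mem_W (s : Seq) : i1 (point s) ∈ W := by
  have key : ∀ r : ℕ, (∃ u : Seq, f^[r] (i1 (point s)) = i1 (point u)) ∨
      ∃ u : Seq, u 0 = 0 ∧ f^[r] (i1 (point s)) = f (i1 (point u)) := by
    intro r
    induction r with
    | zero => exact Or.inl ⟨s, rfl⟩
    | succ r ih =>
      rw [Function.iterate_succ_apply']
      rcases ih with ⟨u, hu⟩ | ⟨u, hu0, hu⟩
      · by_cases h : u 0 = 0
        · exact Or.inr ⟨u, h, by rw [hu]⟩
        · exact Or.inl ⟨shift u, by rw [hu, f_point, fOne_point h]⟩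
      · exact Or.inl ⟨shift u, by rw [hu, f_f_point hu0]⟩
  intro r
  rcases key r with ⟨u, hu⟩ | ⟨u, hu0, hu⟩
  · rw [hu]
    rcases digit_cases (u 0) with h0 | h0 | h0
    · exact Or.inl (Or.inl (Or.inr ((point_mem_edgeC' u).2 h0)))
    · exact Or.inl (Or.inr ((point_mem_edgeOne' u).2 h0))
    · exact Or.inr (point_mem_edgeTwo h0)
  · obtain ⟨h1, h2, h3⟩ := point_mem_of_zero hu0
    rw [hu, f_point, (fOne_point_zero hu0).1]
    exact Or.inl (Or.inl (Or.inl ⟨_, ⟨by linarith, by linarith⟩, rfl⟩))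

/-! ### The orbits of `f_t` through points with itineraries -/

lemma fT_point {t : ℝ} (ht : t ∈ Icc (0 : ℝ) 1) {s : Seq} (hs : point s ≤ lc t) :
    fT t (i1 (point s)) = fOne (point s) := by
  have hl := lc_bounds ht
  rw [fT]
  split_ifs with h
  · rw [i1_mem_arc (by linarith [hl.1]) (by rw [rc_eq]; linarith [hl.1]) (point_nonneg s)
      (by linarith [point_le s])] at h
    rw [ell, le_antisymm h.1 hs, f_point]
  · exact f_point s

lemma fT_i2 {t : ℝ} (ht : t ∈ Icc (0 : ℝ) 1) {q : ℝ} (h0 : 0 < q) (h3 : q < 3) :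
    fT t (i2 q) = fTwo q := by
  have hl := lc_bounds ht
  rw [fT, if_neg (i2_notMem_arc (by linarith [hl.1]) (by rw [rc_eq]; linarith [hl.1]) h0 h3),
    f_i2 h0 h3]

lemma fT_fT_point {t : ℝ} (ht : t ∈ Icc (0 : ℝ) 1) {s : Seq} (h : s 0 = 0) :
    fT t (fT t (i1 (point s))) = i1 (point (shift s)) := by
  obtain ⟨-, h2, h3⟩ := point_mem_of_zero h
  rw [fT_point ht (by linarith [(lc_bounds ht).1]), (fOne_point_zero h).1,
    fT_i2 ht (by linarith) (by linarith), (fOne_point_zero h).2]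

/-- The parameters of `paramSet` are those for which `ℓ(t)` has an itinerary that is at least all
of its shifts. -/
lemma mem_paramSet_iff (t : ℝ) : t ∈ paramSet ↔ t ∈ Icc (0 : ℝ) 1 ∧
    ∃ w : Seq, point w = lc t ∧ ∀ r : ℕ, point (shift^[r] w) ≤ point w := by
  refine and_congr_right fun ht => ?_
  have hl := lc_bounds ht
  have hr := rc_eq t
  constructor
  · rintro ⟨⟨hW, hX⟩, -⟩
    have hw := coord1_eq_point hW (i1_snd (lc t))
    rw [ell, coord1_i1 (by linarith [hl.1]) (by linarith [hl.2])] at hw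
    set w := itinerary (i1 (lc t))
    refine ⟨w, hw.symm, ?_⟩
    have avoid : ∀ (n : ℕ) (u : Seq), (fT t)^[n] (ell t) = i1 (point u) → point u ≤ lc t := by
      intro n u hn
      by_contra hlt
      exact hX n ⟨point u, ⟨not_le.1 hlt, by linarith [point_le u, hl.2]⟩, hn.symm⟩
    have key : ∀ r : ℕ, ∃ n, (fT t)^[n] (ell t) = i1 (point (shift^[r] w)) := by
      intro r
      induction r with
      | zero => exact ⟨0, by rw [ell, hw]; rfl⟩
      | succ r ih =>
        obtain ⟨n, hn⟩ := ih
        have hle := avoid n _ hn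
        rw [Function.iterate_succ_apply']
        by_cases h : shift^[r] w 0 = 0
        · exact ⟨n + 2, by
            rw [Function.iterate_succ_apply', Function.iterate_succ_apply', hn, fT_fT_point ht h]⟩
        · exact ⟨n + 1, by rw [Function.iterate_succ_apply', hn, fT_point ht hle, fOne_point h]⟩
    intro r
    obtain ⟨n, hn⟩ := key r
    rw [← hw]
    exact avoid n _ hn
  · rintro ⟨w, hw, hmax⟩
    rw [hw] at hmax
    refine ⟨⟨by rw [ell, ← hw]; exact point_mem_W w, ?_⟩, ⟨_, rfl⟩⟩
    have key : ∀ n : ℕ, (∃ r, (fT t)^[n] (ell t) = i1 (point (shift^[r] w))) ∨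
        ∃ r, shift^[r] w 0 = 0 ∧ (fT t)^[n] (ell t) = fT t (i1 (point (shift^[r] w))) := by
      intro n
      induction n with
      | zero => exact Or.inl ⟨0, by rw [ell, ← hw]; rfl⟩
      | succ n ih =>
        rw [Function.iterate_succ_apply']
        rcases ih with ⟨r, hn⟩ | ⟨r, h0, hn⟩
        · by_cases h : shift^[r] w 0 = 0
          · exact Or.inr ⟨r, h, by rw [hn]⟩
          · refine Or.inl ⟨r + 1, ?_⟩
            rw [hn, fT_point ht (hmax r), fOne_point h, Function.iterate_succ_apply']
        · exact Or.inl ⟨r + 1, by rw [hn, fT_fT_point ht h0, Function.iterate_succ_apply']⟩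
    intro n hn
    obtain ⟨z, hz, hzn⟩ := hn
    rcases key n with ⟨r, hn⟩ | ⟨r, h0, hn⟩
    · have h1 := congrArg coord1 (hzn.trans hn)
      rw [coord1_i1 (by linarith [hz.1, hl.1]) (by linarith [hz.2, hl.1]),
        coord1_i1 (point_nonneg _) (by linarith [point_le (shift^[r] w)])] at h1
      linarith [hmax r, hz.1]
    · obtain ⟨-, h2, h3⟩ := point_mem_of_zero h0
      rw [fT_point ht (by linarith [hl.1]), (fOne_point_zero h0).1] at hn
      exact i2_snd_ne (by linarith) (by linarith)
        ((congrArg (fun x : X => x.1.2) (hzn.trans hn)).symm.trans (i1_snd z))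

lemma K_eq {t : ℝ} {w : Seq} (hw : point w = lc t) : K t = w := by
  rw [K, ell, ← hw, itinerary_point]

/-! ### The parameter `a(t)` -/

lemma isCompact_paramSet : IsCompact paramSet := by
  have h1 : IsClosed {w : Seq | ∀ r : ℕ, point (shift^[r] w) ≤ point w} := by
    simp only [ofPred_forall]
    exact isClosed_iInter fun r => isClosed_le
      (continuous_point.comp (continuous_shift.iterate r)) continuous_point
  have h2 := (h1.isCompact.image continuous_point).isClosed
  have h3 : Continuous lc := by unfold lc; fun_prop
  have h4 : paramSet = Icc (0 : ℝ) 1 ∩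
      lc ⁻¹' (point '' {w : Seq | ∀ r : ℕ, point (shift^[r] w) ≤ point w}) := by
    ext t
    rw [mem_paramSet_iff]
    refine and_congr_right fun _ => exists_congr fun w => ?_
    exact and_comm
  rw [h4]
  exact isCompact_Icc.inter_right (h2.preimage h3)

/-- The sequence `21^∞`, which is the kneading sequence of the parameter `0`. -/
def twoOnes : Seq := fun n => if n = 0 then 2 else 1

lemma point_twoOnes : point twoOnes = 7 / 2 := by
  rw [point_eq, show twoOnes 0 = 2 from rfl, branch_two, show shift twoOnes = ones from rfl,
    point_ones]
  norm_num

lemma zero_mem_paramSet : (0 : ℝ) ∈ paramSet := by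
  refine (mem_paramSet_iff 0).2 ⟨by norm_num, twoOnes, by rw [point_twoOnes, lc]; norm_num, ?_⟩
  intro r
  rcases r with _ | r
  · exact le_rfl
  · have h : shift^[r + 1] twoOnes = ones := by
      funext n
      rw [shift_iterate]
      rfl
    rw [h, point_ones, point_twoOnes]
    norm_num

lemma isGreatest_a {t : ℝ} (ht : t ∈ Icc (0 : ℝ) 1) :
    IsGreatest {t' | t' ∈ paramSet ∧ t' ≤ t} (a t) := by
  have h1 : IsCompact (paramSet ∩ Iic t) := isCompact_paramSet.inter_right isClosed_Iic
  exact h1.isGreatest_sSup ⟨0, zero_mem_paramSet, ht.1⟩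

lemma a_mem_Icc {t : ℝ} (ht : t ∈ Icc (0 : ℝ) 1) : a t ∈ Icc (0 : ℝ) 1 :=
  (isGreatest_a ht).1.1.1

/-- The kneading sequence of `a(t)` codes the point `ℓ(a(t))`. -/
lemma point_K_a {t : ℝ} (ht : t ∈ Icc (0 : ℝ) 1) : point (K (a t)) = lc (a t) := by
  obtain ⟨-, w, hw, -⟩ := (mem_paramSet_iff _).1 (isGreatest_a ht).1.1
  rw [K_eq hw, hw]

lemma point_K_a_mem {t : ℝ} (ht : t ∈ Icc (0 : ℝ) 1) :
    point (K (a t)) ∈ Icc (7 / 2) (lc t) := by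
  rw [point_K_a ht]
  refine ⟨(lc_bounds (a_mem_Icc ht)).1, ?_⟩
  have := (isGreatest_a ht).1.2
  unfold lc
  linarith

lemma mem_betaShift_iff {s w : Seq} :
    s ∈ betaShift w ↔ ∀ r : ℕ, point (shift^[r] s) ≤ point w :=
  forall_congr' fun _ => point_le_point.symm

/-- If the orbit of `s` stays to the left of `ℓ(t)`, then its supremum is attained on the orbit
closure, by a sequence that is at least all of its shifts; this sequence is either below `21^∞` or
the kneading sequence of a parameter `t' ≤ t`. -/
lemma mem_betaShift_of_point_le {t : ℝ} (ht : t ∈ Icc (0 : ℝ) 1) {s : Seq}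
    (hs : ∀ r : ℕ, point (shift^[r] s) ≤ lc t) : s ∈ betaShift (K (a t)) := by
  rw [mem_betaShift_iff]
  set O := closure (range fun r : ℕ => shift^[r] s) with hO
  have hmem : ∀ r : ℕ, shift^[r] s ∈ O := fun r => subset_closure ⟨r, rfl⟩
  have hmaps : MapsTo shift O O := by
    refine MapsTo.closure ?_ continuous_shift
    rintro _ ⟨r, rfl⟩
    exact ⟨r + 1, Function.iterate_succ_apply' _ _ _⟩
  obtain ⟨u, huO, hu⟩ := (isClosed_closure (s := range fun r : ℕ => shift^[r] s)).isCompact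
    |>.exists_isMaxOn ⟨_, hmem 0⟩ continuous_point.continuousOn
  have hle : point u ≤ lc t :=
    closure_minimal (s := range fun r : ℕ => shift^[r] s) (t := {v | point v ≤ lc t})
      (by rintro _ ⟨r, rfl⟩; exact hs r) (isClosed_le continuous_point continuous_const) huO
  have hK := point_K_a_mem ht
  intro r
  refine (hu (hmem r)).trans ?_
  rcases le_total (point u) (7 / 2) with h | h
  · exact h.trans hK.1
  · have hl : lc ((point u - 7 / 2) * (10 / 3)) = point u := by unfold lc; ring
    have hle' : (point u - 7 / 2) * (10 / 3) ≤ t := by unfold lc at hle; linarith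
    have h1 : (point u - 7 / 2) * (10 / 3) ∈ paramSet :=
      (mem_paramSet_iff _).2 ⟨⟨by linarith, hle'.trans ht.2⟩, u, hl.symm,
        fun r => hu (hmaps.iterate r huO)⟩
    have h2 := (isGreatest_a ht).2 ⟨h1, hle'⟩
    rw [point_K_a ht, ← hl]
    unfold lc
    linarith

/-! ### Digit counts and rotation vectors -/

/-- The number of occurrences of the digit `d` among the first `n` digits of `s`. -/
noncomputable def digitCount (s : Seq) (d : Fin 3) (n : ℕ) : ℝ :=
  ∑ j ∈ Finset.range n, if s j = d then 1 else 0

lemma digitCount_zero (s : Seq) (d : Fin 3) : digitCount s d 0 = 0 := by simp [digitCount]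

lemma digitCount_succ (s : Seq) (d : Fin 3) (n : ℕ) :
    digitCount s d (n + 1) = digitCount s d n + if s n = d then 1 else 0 :=
  Finset.sum_range_succ _ _

lemma digitCount_nonneg (s : Seq) (d : Fin 3) (n : ℕ) : 0 ≤ digitCount s d n :=
  Finset.sum_nonneg fun j _ => by split_ifs <;> norm_num

lemma digitCount_le (s : Seq) (d : Fin 3) (n : ℕ) : digitCount s d n ≤ n := by
  refine (Finset.sum_le_card_nsmul _ _ 1 fun j _ => ?_).trans (by simp)
  split_ifs <;> norm_num

lemma digitCount_add (s : Seq) (n : ℕ) :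
    digitCount s 0 n + digitCount s 1 n + digitCount s 2 n = n := by
  induction n with
  | zero => simp [digitCount_zero]
  | succ n ih =>
    simp only [digitCount_succ]
    push_cast
    rw [← ih]
    rcases digit_cases (s n) with h | h | h <;> simp [h] <;> ring

lemma birkhoffAverage_kappa (s : Seq) (n : ℕ) (d : Fin 3) :
    birkhoffAverage ℝ shift kappa n s d = digitCount s d n / n := by
  rw [birkhoffAverage, birkhoffSum, Pi.smul_apply, Finset.sum_apply, smul_eq_mul, digitCount,
    div_eq_inv_mul]
  congr 1
  refine Finset.sum_congr rfl fun j _ => ?_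
  rw [kappa, shift_iterate, zero_add, Pi.single_apply]
  simp only [eq_comm]

lemma tendsto_div_of_bounded_sub {ι : Type*} {l : Filter ι} {x y r : ι → ℝ} {C c : ℝ}
    (h : ∀ k, |x k - y k| ≤ C) (hr : Tendsto r l atTop)
    (hy : Tendsto (fun k => y k / r k) l (𝓝 c)) : Tendsto (fun k => x k / r k) l (𝓝 c) := by
  have h1 : Tendsto (fun k => (x k - y k) / r k) l (𝓝 0) :=
    tendsto_bdd_div_atTop_nhds_zero (b := -C) (B := C)
      (Eventually.of_forall fun k => (abs_le.1 (h k)).1)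
      (Eventually.of_forall fun k => (abs_le.1 (h k)).2) hr
  have h2 := hy.add h1
  rw [add_zero] at h2
  refine h2.congr fun k => ?_
  ring

/-- If at time `k` an orbit has, up to bounded errors, used up the first `i k` digits of `s` and
moved by the numbers of digits `2` and `0` among them, where the digit `0` takes two units of time
and the other digits take one, then the digit frequencies of `s` give the rotation vector. -/
lemma tendsto_displacement_of_frequency {s : Seq} {α : Fin 3 → ℝ} {D : ℕ → ℝ × ℝ} {i : ℕ → ℕ}
    {C : ℝ} (hα : Tendsto (fun n => birkhoffAverage ℝ shift kappa n s) atTop (𝓝 α))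
    (hi : Tendsto i atTop atTop) (ht : ∀ k : ℕ, |(k : ℝ) - (i k + digitCount s 0 (i k))| ≤ C)
    (h1 : ∀ k, |(D k).1 - digitCount s 2 (i k)| ≤ C)
    (h2 : ∀ k, |(D k).2 - digitCount s 0 (i k)| ≤ C) :
    Tendsto (fun k : ℕ => (k : ℝ)⁻¹ • D k) atTop (𝓝 (PiMap α)) := by
  have hc : ∀ d, Tendsto (fun n : ℕ => digitCount s d n / n) atTop (𝓝 (α d)) := fun d =>
    ((tendsto_pi_nhds.1 hα) d).congr fun n => birkhoffAverage_kappa s n d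
  have hci := fun d => (hc d).comp hi
  have hr : Tendsto (fun k => (i k : ℝ)) atTop atTop := tendsto_natCast_atTop_atTop.comp hi
  have hα0 : 0 ≤ α 0 := ge_of_tendsto' (hc 0) fun n =>
    div_nonneg (digitCount_nonneg _ _ _) n.cast_nonneg
  have t1 := tendsto_div_of_bounded_sub h1 hr (hci 2)
  have t2 := tendsto_div_of_bounded_sub h2 hr (hci 0)
  have t3 : Tendsto (fun k : ℕ => (k : ℝ) / i k) atTop (𝓝 (1 + α 0)) := by
    refine tendsto_div_of_bounded_sub ht hr (((hci 0).const_add 1).congr' ?_)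
    filter_upwards [hr.eventually_gt_atTop 0] with k hk
    simp only [Function.comp]
    field_simp
  have hne : (1 + α 0) ≠ 0 := by linarith
  refine ((t1.div t3 hne).prodMk_nhds (t2.div t3 hne)).congr' ?_
  filter_upwards [hr.eventually_gt_atTop 0] with k hk
  have hk0 := hk.ne'
  ext
  · simp only [Pi.div_apply, Prod.smul_fst, smul_eq_mul]
    rw [div_div_div_cancel_right₀ hk0, div_eq_inv_mul]
  · simp only [Pi.div_apply, Prod.smul_snd, smul_eq_mul]
    rw [div_div_div_cancel_right₀ hk0, div_eq_inv_mul]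

/-- The converse of `tendsto_displacement_of_frequency`: the rotation vector gives the digit
frequencies. Here `T i` is the time at which the first `i` digits have been used up. -/
lemma tendsto_frequency_of_displacement {s : Seq} {v : ℝ × ℝ} {D : ℕ → ℝ × ℝ} {T : ℕ → ℕ}
    {C : ℝ} (hv : Tendsto (fun k : ℕ => (k : ℝ)⁻¹ • D k) atTop (𝓝 v))
    (ht : ∀ i : ℕ, |(T i : ℝ) - (i + digitCount s 0 i)| ≤ C)
    (h1 : ∀ i, |(D (T i)).1 - digitCount s 2 i| ≤ C)
    (h2 : ∀ i, |(D (T i)).2 - digitCount s 0 i| ≤ C) :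
    ∃ α, Tendsto (fun n => birkhoffAverage ℝ shift kappa n s) atTop (𝓝 α) ∧ PiMap α = v := by
  have hr : Tendsto (fun i => (T i : ℝ)) atTop atTop := by
    refine tendsto_atTop_mono (fun i => ?_)
      (tendsto_atTop_add_const_right _ (-C) (tendsto_natCast_atTop_atTop (R := ℝ)))
    linarith [(abs_le.1 (ht i)).1, digitCount_nonneg s 0 i]
  have hv' := hv.comp (tendsto_natCast_atTop_iff.1 hr)
  have d1 : Tendsto (fun i => (D (T i)).1 / T i) atTop (𝓝 v.1) :=
    hv'.fst_nhds.congr fun i => by simp [div_eq_inv_mul]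
  have d2 : Tendsto (fun i => (D (T i)).2 / T i) atTop (𝓝 v.2) :=
    hv'.snd_nhds.congr fun i => by simp [div_eq_inv_mul]
  have t1 := tendsto_div_of_bounded_sub (fun i => by rw [abs_sub_comm]; exact h1 i) hr d1
  have t2 := tendsto_div_of_bounded_sub (fun i => by rw [abs_sub_comm]; exact h2 i) hr d2
  have t3 : Tendsto (fun i : ℕ => (i : ℝ) / T i) atTop (𝓝 (1 - v.2)) := by
    refine tendsto_div_of_bounded_sub (y := fun i => T i - digitCount s 0 i) (C := C)
      (fun i => ?_) hr ((t2.const_sub 1).congr' ?_)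
    · rw [abs_sub_comm, show (T i - digitCount s 0 i - i : ℝ) = T i - (i + digitCount s 0 i) by ring]
      exact ht i
    · filter_upwards [hr.eventually_gt_atTop 0] with i hi
      field_simp
  have hle : v.2 ≤ 1 - v.2 := le_of_tendsto_of_tendsto' t2 t3 fun i =>
    div_le_div_of_nonneg_right (digitCount_le s 0 i) (T i).cast_nonneg
  have hne : 1 - v.2 ≠ 0 := by
    have h0 : 0 ≤ v.2 := ge_of_tendsto' t2 fun i =>
      div_nonneg (digitCount_nonneg _ _ _) (T i).cast_nonneg
    linarith
  have f0 : Tendsto (fun i : ℕ => digitCount s 0 i / i) atTop (𝓝 (v.2 / (1 - v.2))) := by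
    refine (t2.div t3 hne).congr' ?_
    filter_upwards [hr.eventually_gt_atTop 0] with i hi
    exact div_div_div_cancel_right₀ hi.ne' _ _
  have f2 : Tendsto (fun i : ℕ => digitCount s 2 i / i) atTop (𝓝 (v.1 / (1 - v.2))) := by
    refine (t1.div t3 hne).congr' ?_
    filter_upwards [hr.eventually_gt_atTop 0] with i hi
    exact div_div_div_cancel_right₀ hi.ne' _ _
  have f1 : Tendsto (fun i : ℕ => digitCount s 1 i / i) atTop
      (𝓝 (1 - v.2 / (1 - v.2) - v.1 / (1 - v.2))) := by
    refine ((f0.const_sub 1).sub f2).congr' ?_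
    filter_upwards [eventually_gt_atTop 0] with i hi
    have hi' : (i : ℝ) ≠ 0 := by positivity
    have := digitCount_add s i
    field_simp
    linarith
  refine ⟨![v.2 / (1 - v.2), 1 - v.2 / (1 - v.2) - v.1 / (1 - v.2), v.1 / (1 - v.2)], ?_, ?_⟩
  · refine tendsto_pi_nhds.2 fun d => ?_
    simp only [birkhoffAverage_kappa]
    rcases digit_cases d with rfl | rfl | rfl
    · exact f0
    · exact f1
    · exact f2
  · have h : 1 + v.2 / (1 - v.2) = 1 / (1 - v.2) := by field_simp; ring
    ext
    · simp [PiMap, h, hne]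
    · simp [PiMap, h, hne]

/-! ### Displacements, and the orbits with itineraries in the `β`-shift -/

lemma gamma_i1 (t : ℝ) {z : ℝ} (h0 : 0 ≤ z) (h5 : z < 5) :
    gamma t (i1 z) = e1 t z - (z / 5, 0) := by
  have hp : proj ⟨(z / 5, 0), Or.inl ⟨0, by simp⟩⟩ = i1 z :=
    X_ext (by simp only [proj, i1]; congr 1; ring) (by simp [proj, i1])
  have hf : ⌊z / 5⌋ = 0 := Int.floor_eq_zero_iff.2 ⟨by positivity, by linarith⟩
  have hz : 5 * (z / 5) = z := by ring
  rw [← hp, gamma_proj]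
  simp only [lift, hf, Int.fract, Int.floor_zero, Int.cast_zero, sub_zero, mul_zero, e2_zero,
    add_zero, hz]
  rw [show ((0 : ℝ), (0 : ℝ)) = 0 from rfl, zero_add]

lemma gamma_i2 (t : ℝ) {q : ℝ} (h0 : 0 ≤ q) (h3 : q < 3) :
    gamma t (i2 q) = e2 q - (0, q / 3) := by
  have hp : proj ⟨(0, q / 3), Or.inr ⟨0, by simp⟩⟩ = i2 q :=
    X_ext (by simp [proj, i2]) (by simp only [proj, i2]; congr 1; ring)
  have hf : ⌊q / 3⌋ = 0 := Int.floor_eq_zero_iff.2 ⟨by positivity, by linarith⟩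
  have hz : 3 * (q / 3) = q := by ring
  rw [← hp, gamma_proj]
  simp only [lift, hf, Int.fract, Int.floor_zero, Int.cast_zero, sub_zero, mul_zero, e1_zero,
    add_zero, hz]
  rw [show ((0 : ℝ), (0 : ℝ)) = 0 from rfl, zero_add]

lemma birkhoffSum_succ_gamma (t : ℝ) (k : ℕ) (x : X) :
    birkhoffSum (fT t) (gamma t) (k + 1) x =
      birkhoffSum (fT t) (gamma t) k x + gamma t ((fT t)^[k] x) :=
  birkhoffSum_succ _ _ _ _

/-- The displacement along the orbit of the point with itinerary `s`: at each time `k`, the orbit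
has either completed `i` digits of `s`, or it has completed `i` digits and is in the middle of a
digit `0`, in the segment `B'`. -/
lemma orbit_point {t : ℝ} (ht : t ∈ Icc (0 : ℝ) 1) {s : Seq}
    (hs : ∀ r : ℕ, point (shift^[r] s) ≤ lc t) (k : ℕ) : ∃ i : ℕ,
    ((fT t)^[k] (i1 (point s)) = i1 (point (shift^[i] s)) ∧ (k : ℝ) = i + digitCount s 0 i ∧
      birkhoffSum (fT t) (gamma t) k (i1 (point s)) =
        (digitCount s 2 i + (point (shift^[i] s) - point s) / 5, digitCount s 0 i)) ∨
    (s i = 0 ∧ (fT t)^[k] (i1 (point s)) = i2 (3 * point (shift^[i] s)) ∧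
      (k : ℝ) = i + digitCount s 0 i + 1 ∧
      birkhoffSum (fT t) (gamma t) k (i1 (point s)) =
        (digitCount s 2 i - point s / 5, digitCount s 0 i + point (shift^[i] s))) := by
  have hl := lc_bounds ht
  induction k with
  | zero => exact ⟨0, Or.inl ⟨rfl, by simp [digitCount_zero], by simp [digitCount_zero]; rfl⟩⟩
  | succ k ih =>
    rw [Function.iterate_succ_apply', birkhoffSum_succ_gamma]
    obtain ⟨i, ⟨h1, h2, h3⟩ | ⟨h0, h1, h2, h3⟩⟩ := ih
    · have hi : shift^[i] s 0 = s i := by rw [shift_iterate, zero_add]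
      have hg := gamma_i1 t (point_nonneg (shift^[i] s)) (by linarith [point_le (shift^[i] s)])
      rw [h1, h3, hg, fT_point ht (hs i)]
      push_cast
      rcases digit_cases (s i) with h | h | h
      · rw [← hi] at h
        obtain ⟨e, b1, b2⟩ := point_mem_of_zero h
        refine ⟨i, Or.inr ⟨hi ▸ h, (fOne_point_zero h).1, by rw [h2], ?_⟩⟩
        rw [e1, if_pos (by linarith)]
        ext <;> simp; ring
      · rw [← hi] at h
        obtain ⟨e, b1, b2⟩ := point_mem_of_one h
        refine ⟨i + 1, Or.inl ⟨?_, ?_, ?_⟩⟩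
        · rw [fOne_point (by simp [h]), Function.iterate_succ_apply']
        · rw [digitCount_succ, ← hi, h, h2]
          push_cast
          simp
          ring
        · rw [e1, if_neg (by linarith), if_neg (by linarith), if_pos (by linarith [hl.1]),
            digitCount_succ, digitCount_succ, ← hi, h, Function.iterate_succ_apply']
          ext
          · simp
            linarith
          · simp
      · rw [← hi] at h
        obtain ⟨e, b1, b2⟩ := point_mem_of_two h
        refine ⟨i + 1, Or.inl ⟨?_, ?_, ?_⟩⟩
        · rw [fOne_point (by simp [h]), Function.iterate_succ_apply']
        · rw [digitCount_succ, ← hi, h, h2]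
          push_cast
          simp
          ring
        · rw [e1, if_neg (by linarith), if_neg (by linarith), if_pos (hs i),
            digitCount_succ, digitCount_succ, ← hi, h, Function.iterate_succ_apply']
          ext
          · simp
            linarith
          · simp
    · have hi : shift^[i] s 0 = 0 := by rw [shift_iterate, zero_add, h0]
      obtain ⟨e, b1, b2⟩ := point_mem_of_zero hi
      have hg := gamma_i2 t (q := 3 * point (shift^[i] s)) (by linarith) (by linarith)
      rw [h1, h3, hg, fT_i2 ht (by linarith) (by linarith)]
      refine ⟨i + 1, Or.inl ⟨?_, ?_, ?_⟩⟩
      · rw [(fOne_point_zero hi).2, Function.iterate_succ_apply']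
      · rw [digitCount_succ, h0]
        push_cast
        rw [h2]
        ring
      · rw [e2, if_neg (by linarith), if_pos (by linarith),
            digitCount_succ, digitCount_succ, h0, Function.iterate_succ_apply']
        ext
        · simp
          linarith
        · simp

lemma piMap_mem_rho8 {t : ℝ} (ht : t ∈ Icc (0 : ℝ) 1) {s : Seq}
    (hs : ∀ r : ℕ, point (shift^[r] s) ≤ lc t) {α : Fin 3 → ℝ}
    (hα : Tendsto (fun n => birkhoffAverage ℝ shift kappa n s) atTop (𝓝 α)) :
    PiMap α ∈ rho8 t := by
  refine ⟨i1 (point s), mem_univ _, ?_⟩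
  choose i hi using orbit_point ht hs
  have hp : ∀ u : Seq, 0 ≤ point u ∧ point u ≤ 15 / 4 := fun u => ⟨point_nonneg u, point_le u⟩
  refine tendsto_displacement_of_frequency (s := s) (i := i) (C := 4) hα ?_ ?_ ?_ ?_
  · refine tendsto_atTop.2 fun b => ?_
    filter_upwards [eventually_ge_atTop (2 * b + 1)] with k hk
    have h1 : (k : ℝ) ≤ 2 * i k + 1 := by
      have := digitCount_le s 0 (i k)
      rcases hi k with h | h
      · linarith [h.2.1]
      · linarith [h.2.2.1]
    have h2 : k ≤ 2 * i k + 1 := by exact_mod_cast h1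
    omega
  · intro k
    rcases hi k with h | h
    · rw [h.2.1]; norm_num
    · rw [h.2.2.1]; norm_num
  · intro k
    have h1 := hp (shift^[i k] s)
    have h2 := hp s
    rw [abs_le]
    rcases hi k with h | h
    · rw [h.2.2]
      constructor <;> simp <;> linarith
    · rw [h.2.2.2]
      constructor <;> simp <;> linarith
  · intro k
    have h1 := hp (shift^[i k] s)
    rw [abs_le]
    rcases hi k with h | h
    · rw [h.2.2]
      constructor <;> simp
    · rw [h.2.2.2]
      constructor <;> simp <;> linarith

/-! ### Moving marked digits -/

/-- From the position `i` on, a marked position comes before any digit `2`. -/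
def MarkAhead (e : Seq) (A : ℕ → Prop) (i : ℕ) : Prop := ∃ m, A (i + m) ∧ ∀ j < m, e (i + j) ≠ 2

/-- The positions after a digit `2`, up to and including the first marked position, when that
marked position comes before the next digit `2`. -/
def InZone (e : Seq) (A : ℕ → Prop) : ℕ → Prop
  | 0 => False
  | i + 1 => (e i = 2 ∧ MarkAhead e A (i + 1)) ∨ (InZone e A i ∧ ¬ A i)

open Classical in
/-- The sequence obtained from `e` by moving, for each digit `2` that is followed by a marked
position before the next digit `2`, the first such marked digit `1` to the place just before the
digit `2`. -/
noncomputable def rearrange (e : Seq) (A : ℕ → Prop) : Seq := fun i =>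
  if e i = 2 ∧ MarkAhead e A (i + 1) then 1 else if InZone e A i then e (i - 1) else e i

section Rearrange

variable {e : Seq} {A : ℕ → Prop}

lemma markAhead_iff (i : ℕ) : MarkAhead e A i ↔ A i ∨ (e i ≠ 2 ∧ MarkAhead e A (i + 1)) := by
  constructor
  · rintro ⟨m, hm, h⟩
    rcases m with _ | m
    · exact Or.inl hm
    · refine Or.inr ⟨h 0 m.succ_pos, m, ?_, fun j hj => ?_⟩
      · rwa [add_assoc, add_comm 1 m]
      · rw [add_assoc, add_comm 1 j]
        exact h (j + 1) (by omega)
  · rintro (h | ⟨h0, m, hm, h⟩)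
    · exact ⟨0, h, fun j hj => absurd hj (Nat.not_lt_zero j)⟩
    · refine ⟨m + 1, by rwa [add_assoc, add_comm 1 m] at hm, fun j hj => ?_⟩
      rcases j with _ | j
      · exact h0
      · have := h j (by omega)
        rwa [add_assoc, add_comm 1 j] at this

lemma InZone.markAhead {i : ℕ} (h : InZone e A i) : MarkAhead e A i := by
  induction i with
  | zero => exact h.elim
  | succ i ih =>
    rcases h with h | h
    · exact h.2
    · exact (((markAhead_iff i).1 (ih h.1)).resolve_left h.2).2

lemma rearrange_of_two {i : ℕ} (h : e i = 2) (hN : MarkAhead e A (i + 1)) :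
    rearrange e A i = 1 := if_pos ⟨h, hN⟩

lemma MarkAhead.ne_two (hAe : ∀ i, A i → e i = 1) {i : ℕ} (h : MarkAhead e A i) : e i ≠ 2 := by
  rcases (markAhead_iff i).1 h with h | h
  · simp [hAe i h]
  · exact h.1

lemma rearrange_of_inZone (hAe : ∀ i, A i → e i = 1) {i : ℕ} (h : InZone e A (i + 1)) :
    rearrange e A (i + 1) = e i := by
  rw [rearrange, if_neg fun h' => h.markAhead.ne_two hAe h'.1, if_pos h, Nat.add_sub_cancel]

lemma rearrange_of_not {i : ℕ} (h : ¬ (e i = 2 ∧ MarkAhead e A (i + 1))) (h' : ¬ InZone e A i) :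
    rearrange e A i = e i := by
  rw [rearrange, if_neg h, if_neg h']

open Classical in
lemma digitCount_rearrange (hAe : ∀ i, A i → e i = 1) (d : Fin 3) (n : ℕ) :
    digitCount (rearrange e A) d n = digitCount e d n +
      if InZone e A n then (if (1 : Fin 3) = d then 1 else 0) - (if e (n - 1) = d then 1 else 0)
      else 0 := by
  induction n with
  | zero => simp [digitCount_zero, InZone]
  | succ n ih =>
    rw [digitCount_succ, digitCount_succ, ih, Nat.add_sub_cancel]
    by_cases h : e n = 2 ∧ MarkAhead e A (n + 1)
    · have h1 : ¬ InZone e A n := fun h' => h'.markAhead.ne_two hAe h.1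
      have h2 : InZone e A (n + 1) := Or.inl h
      rw [if_neg h1, if_pos h2, rearrange_of_two h.1 h.2]
      ring
    by_cases h1 : InZone e A n
    · obtain ⟨m, rfl⟩ : ∃ m, n = m + 1 := Nat.exists_eq_succ_of_ne_zero (by rintro rfl; exact h1)
      rw [if_pos h1, rearrange_of_inZone hAe h1, Nat.add_sub_cancel]
      by_cases hA : A (m + 1)
      · have h2 : ¬ InZone e A (m + 1 + 1) := by
          rintro (h' | h')
          · exact h h'
          · exact h'.2 hA
        rw [if_neg h2, hAe _ hA]
        ring
      · have h2 : InZone e A (m + 1 + 1) := Or.inr ⟨h1, hA⟩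
        rw [if_pos h2]
        ring
    · have h2 : ¬ InZone e A (n + 1) := by
        rintro (h' | h')
        · exact h h'
        · exact h1 h'.1
      rw [if_neg h1, if_neg h2, rearrange_of_not h h1]
      ring

lemma abs_digitCount_rearrange_sub_le (hAe : ∀ i, A i → e i = 1) (d : Fin 3) (n : ℕ) :
    |digitCount (rearrange e A) d n - digitCount e d n| ≤ 1 := by
  rw [digitCount_rearrange hAe, add_sub_cancel_left]
  split_ifs <;> norm_num

lemma branch_le_three {d : Fin 3} (hd : d ≠ 2) {x : ℝ} (hx : x ≤ 15 / 4) : branch d x ≤ 3 := by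
  rcases digit_cases d with rfl | rfl | rfl
  · rw [branch_zero]; linarith
  · rw [branch_one]; linarith
  · exact absurd rfl hd

/-- Before a digit `2`, if no marked position intervenes, the rearranged sequence is bounded by the
heights `y`: both follow the same branches, until the rearranged sequence has `1` instead of `2`. -/
lemma point_rearrange_le_height {y : ℕ → ℝ} (hy0 : ∀ i, 0 ≤ y i)
    (hy : ∀ i, ¬ A i → ¬ A (i + 1) → branch (e i) (y (i + 1)) ≤ y i)
    (hy3 : ∀ i, e i = 2 → 3 ≤ y i) {i : ℕ} (hi : ¬ MarkAhead e A i) :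
    point (shift^[i] (rearrange e A)) ≤ y i := by
  refine le_of_forall_le_add_pow (c := 4) fun d => ?_
  induction d generalizing i with
  | zero => linarith [point_le (shift^[i] (rearrange e A)), hy0 i]
  | succ d ih =>
    have hpow : (0 : ℝ) ≤ 4 * (1 / 5) ^ d := by positivity
    rw [point_iterate]
    by_cases h : e i = 2 ∧ MarkAhead e A (i + 1)
    · rw [rearrange_of_two h.1 h.2]
      have h1 := branch_le_three (d := 1) (by decide)
        (point_le (shift^[i + 1] (rearrange e A)))
      rw [pow_succ]
      linarith [hy3 i h.1]
    · have hA : ¬ A i := fun hA => hi ((markAhead_iff i).2 (Or.inl hA))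
      have hN : ¬ MarkAhead e A (i + 1) := fun hN => by
        by_cases h2 : e i = 2
        · exact h ⟨h2, hN⟩
        · exact hi ((markAhead_iff i).2 (Or.inr ⟨h2, hN⟩))
      have hA' : ¬ A (i + 1) := fun hA => hN ((markAhead_iff _).2 (Or.inl hA))
      rw [rearrange_of_not h fun h' => hi h'.markAhead, pow_succ, ← mul_assoc]
      refine (branch_mono _ (ih hN)).trans ((branch_add_le _ _ hpow).trans ?_)
      linarith [hy i hA hA']

/-- After a digit `2` that has been delayed there is a digit `0` before the next `2`, since a
marked position is preceded by a digit `0`. So what follows it is at most `1^∞`. -/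
lemma point_rearrange_le_ones (hAe : ∀ i, A i → e i = 1) (hA : ∀ i, A (i + 1) → A i ∨ e i = 0)
    {i : ℕ} (hi : InZone e A (i + 1)) (h2 : e i ≠ 2) :
    point (shift^[i + 1] (rearrange e A)) ≤ 5 / 2 := by
  refine le_of_forall_le_add_pow (c := 4) fun d => ?_
  induction d generalizing i with
  | zero => linarith [point_le (shift^[i + 1] (rearrange e A))]
  | succ d ih =>
    have hpow : (0 : ℝ) ≤ 4 * (1 / 5) ^ d := by positivity
    rw [point_iterate, rearrange_of_inZone hAe hi, pow_succ]
    rcases digit_cases (e i) with h | h | h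
    · rw [h, branch_zero]
      linarith [point_le (shift^[i + 1 + 1] (rearrange e A))]
    · have hAi : ¬ A i := (hi.resolve_left fun h' => h2 h'.1).2
      have hAi' : ¬ A (i + 1) := fun h' => (hA i h').elim hAi (by simp [h])
      have h1 := ih (i := i + 1) (Or.inr ⟨hi, hAi'⟩) (hi.markAhead.ne_two hAe)
      rw [h, branch_one]
      linarith
    · exact absurd h h2

/-- All shifts of the rearranged sequence code points to the left of `M`. -/
lemma point_rearrange_le {y : ℕ → ℝ} {M : ℝ} (hM : 7 / 2 ≤ M) (hAe : ∀ i, A i → e i = 1)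
    (hA : ∀ i, A (i + 1) → A i ∨ e i = 0) (hy0 : ∀ i, 0 ≤ y i)
    (hy : ∀ i, ¬ A i → ¬ A (i + 1) → branch (e i) (y (i + 1)) ≤ y i)
    (hy3 : ∀ i, e i = 2 → 3 ≤ y i) (hyM : ∀ i, e i = 2 → y i ≤ M) (r : ℕ) :
    point (shift^[r] (rearrange e A)) ≤ M := by
  have small : rearrange e A r ≠ 2 → point (shift^[r] (rearrange e A)) ≤ M := fun h => by
    rw [point_iterate]
    linarith [branch_le_three h (point_le (shift^[r + 1] (rearrange e A)))]
  by_cases h : e r = 2 ∧ MarkAhead e A (r + 1)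
  · exact small (by rw [rearrange_of_two h.1 h.2]; decide)
  by_cases hz : InZone e A r
  · obtain ⟨i, rfl⟩ : ∃ i, r = i + 1 := Nat.exists_eq_succ_of_ne_zero (by rintro rfl; exact hz)
    by_cases h2 : e i = 2
    · have hAi : ¬ A (i + 1) := fun h' =>
        (hA i h').elim (fun h'' => by simp [hAe i h''] at h2) (by simp [h2])
      have h1 := point_rearrange_le_ones hAe hA (i := i + 1) (Or.inr ⟨hz, hAi⟩)
        (hz.markAhead.ne_two hAe)
      rw [point_iterate, rearrange_of_inZone hAe hz, h2, branch_two]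
      linarith
    · exact small (by rwa [rearrange_of_inZone hAe hz])
  · by_cases h2 : e r = 2
    · exact (point_rearrange_le_height hy0 hy hy3 fun h' => h'.ne_two hAe h2).trans (hyM r h2)
    · exact small (by rwa [rearrange_of_not h hz])

end Rearrange

/-! ### Coding of arbitrary orbits of `f_t` -/

/-- The digit of a point: `0` on `C ∪ c`, `2` on `2 ∪ 2ʳ`, and `1` both on the edge `1` and
on `S₂`. -/
noncomputable def letter (u : X) : Fin 3 :=
  if u.1.2 = 0 then if coord1 u < 2 then 0 else if coord1 u < 3 then 1 else 2 else 1

/-- The point of the edge `C`, `1` or `2` with the same image under `f_t` as the point of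
coordinate `z` of `S₁`: the edges `c` and `2ʳ` are folded onto `C` and `2`, and then the part of
`2` after `ℓ(t)` is moved to `ℓ(t)`. -/
noncomputable def height (t z : ℝ) : ℝ :=
  if z ≤ 1 then z else if z ≤ 2 then 2 - z else if z ≤ 3 then z else min (min z (8 - z)) (lc t)

/-- The indicator function of `S₂` without the vertex. -/
noncomputable def markVal (u : X) : ℝ := if u.1.2 = 0 then 0 else 1

lemma height_nonneg {t z : ℝ} (ht : t ∈ Icc (0 : ℝ) 1) (h0 : 0 ≤ z) (h5 : z < 5) :
    0 ≤ height t z := by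
  have hl := lc_bounds ht
  unfold height
  split_ifs
  · exact h0
  · linarith
  · exact h0
  · exact le_min (le_min h0 (by linarith)) (by linarith [hl.1])

lemma height_le {t z : ℝ} : height t z ≤ z := by
  unfold height
  split_ifs
  · exact le_rfl
  · linarith
  · exact le_rfl
  · exact (min_le_left _ _).trans (min_le_left _ _)

lemma fT_i1 {t z : ℝ} (ht : t ∈ Icc (0 : ℝ) 1) (h0 : 0 ≤ z) (h5 : z < 5) :
    fT t (i1 z) = if z ≤ 2 then i2 (3 * height t z) else
      if z ≤ 3 then i1 (5 * (z - 2)) else i1 (5 * (height t z - 3)) := by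
  have hl := lc_bounds ht
  have hr := rc_eq t
  have he : f (ell t) = i1 (5 * (lc t - 3)) := by
    rw [ell, f_i1 (by linarith [hl.1]) (by linarith [hl.2]), fOne, if_neg (by linarith [hl.1]),
      if_neg (by linarith [hl.1]), if_neg (by linarith [hl.1]), if_pos (by linarith [hl.2])]
  rw [fT, i1_mem_arc (by linarith [hl.1]) (by linarith [hl.1]) h0 h5, he, f_i1 h0 h5, hr]
  by_cases hI : z ∈ Icc (lc t) (8 - lc t)
  · rw [if_pos hI, if_neg (by linarith [hI.1, hl.1]), if_neg (by linarith [hI.1, hl.1]), height,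
      if_neg (by linarith [hI.1, hl.1]), if_neg (by linarith [hI.1, hl.1]),
      if_neg (by linarith [hI.1, hl.1]), min_eq_right (le_min hI.1 (by linarith [hI.2]))]
  rw [if_neg hI]
  unfold fOne height
  by_cases h1 : z ≤ 1
  · simp only [if_pos h1, if_pos (h1.trans one_le_two)]
  by_cases h2 : z ≤ 2
  · simp only [if_neg h1, if_pos h2]
  by_cases h3 : z ≤ 3
  · simp only [if_neg h1, if_neg h2, if_pos h3]
  simp only [if_neg h1, if_neg h2, if_neg h3]
  by_cases h4 : z ≤ 4
  · have h6 : z < lc t := by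
      by_contra h
      exact hI ⟨not_lt.1 h, by linarith [hl.2]⟩
    rw [if_pos h4, min_eq_left (by linarith : z ≤ 8 - z), min_eq_left h6.le]
  · have h6 : 8 - z < lc t := by
      by_contra h
      exact hI ⟨by linarith [hl.2], by linarith⟩
    rw [if_neg h4, min_eq_right (by linarith : 8 - z ≤ z), min_eq_left h6.le]
    congr 1
    ring

lemma gamma_i1_height {t z : ℝ} (ht : t ∈ Icc (0 : ℝ) 1) (h0 : 0 ≤ z) (h5 : z < 5) :
    gamma t (i1 z) = (if z ≤ 2 then (0, height t z) else
      if z ≤ 3 then (z - 2, 0) else (height t z - 2, 0)) - (z / 5, 0) := by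
  have hl := lc_bounds ht
  have hr := rc_eq t
  rw [gamma_i1 t h0 h5, e1]
  congr 1
  unfold height
  by_cases h1 : z ≤ 1
  · simp only [if_pos h1, if_pos (h1.trans one_le_two)]
  by_cases h2 : z ≤ 2
  · simp only [if_neg h1, if_pos h2]
  by_cases h3 : z ≤ 3
  · simp only [if_neg h1, if_neg h2, if_pos h3, if_pos (h3.trans (by linarith [hl.1] : 3 ≤ lc t))]
  simp only [if_neg h1, if_neg h2, if_neg h3]
  by_cases h4 : z ≤ lc t
  · rw [if_pos h4, min_eq_left (by linarith [hl.2] : z ≤ 8 - z), min_eq_left h4]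
  by_cases h6 : z ≤ rc t
  · rw [if_neg h4, if_pos h6, min_eq_right (le_min (not_le.1 h4).le (by linarith))]
  · rw [if_neg h4, if_neg h6, min_eq_right (by linarith [hl.2] : 8 - z ≤ z),
      min_eq_left (by linarith)]
    congr 1
    ring

/-- The orbit of `u` under `f_t` does not contain the vertex. -/
def AvoidsVertex (t : ℝ) (u : X) : Prop := ∀ n : ℕ, (fT t)^[n] u ≠ i1 0

lemma AvoidsVertex.iterate {t : ℝ} {u : X} (h : AvoidsVertex t u) (k : ℕ) :
    AvoidsVertex t ((fT t)^[k] u) := fun n => by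
  rw [← Function.iterate_add_apply]
  exact h _

/-- The edges `B` and `b` are folded together and mapped over `S₁`. -/
lemma fT_i2_of_one_le {t q : ℝ} (ht : t ∈ Icc (0 : ℝ) 1) (h1 : 1 ≤ q) (h3 : q < 3)
    (ha : AvoidsVertex t (i2 q)) : ∃ z ∈ Ioo (0 : ℝ) 5, fT t (i2 q) = i1 z ∧ z ≤ 5 * (q - 1) ∧
      gamma t (i2 q) = (z / 5, 1) - (0, q / 3) := by
  have hf := fT_i2 ht (by linarith) h3
  have ha1 := ha 1
  rw [Function.iterate_one, hf] at ha1
  rw [hf, gamma_i2 t (by linarith) h3]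
  rcases h1.eq_or_lt with rfl | h1
  · refine absurd ?_ ha1
    rw [fTwo, if_pos le_rfl, mul_one, i2_three]
  rcases le_or_gt q 2 with h2 | h2
  · rw [fTwo, if_neg (by linarith), if_pos h2] at ha1 ⊢
    have h2' : q ≠ 2 := by
      rintro rfl
      refine ha1 ?_
      rw [show (5 : ℝ) * (2 - 1) = 5 by norm_num, i1_five]
    have h2'' := lt_of_le_of_ne h2 h2'
    refine ⟨_, ⟨by linarith, by linarith⟩, rfl, le_rfl, ?_⟩
    rw [e2, if_neg (by linarith), if_pos h2]
    congr 2
    ring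
  · rw [fTwo, if_neg (by linarith), if_neg (by linarith)]
    refine ⟨_, ⟨by linarith, by linarith⟩, rfl, by linarith, ?_⟩
    rw [e2, if_neg (by linarith), if_neg (by linarith)]
    congr 2
    ring

/-- The orbit of `u` avoids the vertex, and `u` is in `S₁` or in the edge `A`. -/
def Good (t : ℝ) (u : X) : Prop :=
  AvoidsVertex t u ∧ (u.1.2 = 0 ∨ ∃ q ∈ Ioo (0 : ℝ) 1, u = i2 q)

/-- From `u` the orbit goes in `k` steps to a good point. The count of time and displacement
credits a visit to `A` with the unit of time and the displacement of the visit to `B ∪ b` that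
ends it. -/
structure IsStep (t : ℝ) (u : X) (k : ℕ) : Prop where
  good : Good t ((fT t)^[k] u)
  time : (k : ℝ) = 1 + (if letter u = 0 then 1 else 0) + markVal u - markVal ((fT t)^[k] u)
  sum_fst : (birkhoffSum (fT t) (gamma t) k u).1 = (if letter u = 2 then 1 else 0) +
    coord1 ((fT t)^[k] u) / 5 - coord1 u / 5
  sum_snd : (birkhoffSum (fT t) (gamma t) k u).2 = (if letter u = 0 then 1 else 0) + markVal u -
    markVal ((fT t)^[k] u) + coord2 ((fT t)^[k] u) / 3 - coord2 u / 3
  mark : ((fT t)^[k] u).1.2 ≠ 0 → u.1.2 ≠ 0 ∨ letter u = 0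
  height : u.1.2 = 0 → ((fT t)^[k] u).1.2 = 0 →
    branch (letter u) (height t (coord1 ((fT t)^[k] u))) ≤ FigureEight.height t (coord1 u)

lemma markVal_i1 (z : ℝ) : markVal (i1 z) = 0 := if_pos rfl

lemma markVal_i2 {q : ℝ} (h0 : 0 < q) (h3 : q < 3) : markVal (i2 q) = 1 :=
  if_neg (i2_snd_ne h0 h3)

lemma coord2_i1 (z : ℝ) : coord2 (i1 z) = 0 := by
  rw [← coord2_i2 le_rfl (by norm_num : (0 : ℝ) < 3)]
  simp [coord2, i1, i2]

lemma coord1_i2 (q : ℝ) : coord1 (i2 q) = 0 := by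
  rw [← coord1_i1 le_rfl (by norm_num : (0 : ℝ) < 5)]
  simp [coord1, i1, i2]

lemma letter_i1 {z : ℝ} (h0 : 0 ≤ z) (h5 : z < 5) :
    letter (i1 z) = if z < 2 then 0 else if z < 3 then 1 else 2 := by
  rw [letter, if_pos (i1_snd z), coord1_i1 h0 h5]

lemma letter_i2 {q : ℝ} (h0 : 0 < q) (h3 : q < 3) : letter (i2 q) = 1 :=
  if_neg (i2_snd_ne h0 h3)

/-- A step from a point `u` that is mapped to the point of coordinate `3h` of `S₂`. It ends there
if that point is in `A`, and one unit of time later otherwise. -/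
lemma isStep_of_i2 {t h : ℝ} {u : X} (ht : t ∈ Icc (0 : ℝ) 1) (ha : AvoidsVertex t u)
    (h0 : 0 < h) (h1 : h < 1) (hu : fT t u = i2 (3 * h))
    (hg1 : (gamma t u).1 = -(coord1 u / 5)) (hg2 : (gamma t u).2 = h - coord2 u / 3)
    (hl : (if letter u = 0 then 1 else 0) + markVal u = 1) (hl2 : letter u ≠ 2)
    (hm : u.1.2 ≠ 0 ∨ letter u = 0) (hh : u.1.2 = 0 → height t (coord1 u) = h) :
    ∃ k, IsStep t u k := by
  rcases lt_or_ge (3 * h) 1 with h3 | h3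
  · have hk : (fT t)^[1] u = i2 (3 * h) := hu
    refine ⟨1, ⟨⟨ha.iterate 1, Or.inr ⟨_, ⟨by linarith, h3⟩, hk⟩⟩, ?_, ?_, ?_, fun _ => hm, ?_⟩⟩
    · rw [hk, markVal_i2 (by linarith) (by linarith)]
      push_cast
      linarith
    · rw [hk, birkhoffSum_one, hg1, if_neg hl2, coord1_i2]
      ring
    · rw [hk, birkhoffSum_one, hg2, hl, coord2_i2 (by linarith) (by linarith),
        markVal_i2 (by linarith) (by linarith)]
      ring
    · intro _ h'
      rw [hk] at h'
      exact absurd h' (i2_snd_ne (by linarith) (by linarith))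
  · have ha1 : AvoidsVertex t (i2 (3 * h)) := hu ▸ ha.iterate 1
    obtain ⟨z, hz, hf, hle, hg⟩ := fT_i2_of_one_le ht h3 (by linarith) ha1
    have hk : (fT t)^[2] u = i1 z := by
      rw [Function.iterate_succ_apply, Function.iterate_one, hu, hf]
    have hs : birkhoffSum (fT t) (gamma t) 2 u = gamma t u + gamma t (i2 (3 * h)) := by
      rw [birkhoffSum_succ_gamma, birkhoffSum_one, Function.iterate_one, hu]
    refine ⟨2, ⟨⟨ha.iterate 2, Or.inl (by rw [hk]; rfl)⟩, ?_, ?_, ?_, fun _ => hm, ?_⟩⟩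
    · rw [hk, markVal_i1]
      push_cast
      linarith
    · rw [hk, hs, if_neg hl2, coord1_i1 hz.1.le hz.2, Prod.fst_add, hg1, hg]
      simp
      ring
    · rw [hk, hs, hl, coord2_i1, markVal_i1, Prod.snd_add, hg2, hg]
      simp
    · intro h' _
      have hl0 := hm.resolve_left (not_not.2 h')
      rw [hk, hh h', hl0, coord1_i1 hz.1.le hz.2, branch_zero]
      have := height_le (t := t) (z := z)
      linarith

/-- A step from a point `u` of the edges `1`, `2` and `2ʳ`. -/
lemma isStep_of_i1 {t z w : ℝ} {u : X} (ha : AvoidsVertex t u) (hu0 : u.1.2 = 0)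
    (hw0 : 0 ≤ w) (hw5 : w < 5) (hu : fT t u = i1 w)
    (hg : gamma t u = ((if letter u = 2 then 1 else 0) + w / 5 - z / 5, 0)) (hz : coord1 u = z)
    (hl : letter u ≠ 0) (hb : branch (letter u) w = height t z) : IsStep t u 1 := by
  have hk : (fT t)^[1] u = i1 w := hu
  have hm : markVal u = 0 := if_pos hu0
  have hc : coord2 u = 0 := by rw [← i1_coord1 u hu0, coord2_i1]
  refine ⟨⟨ha.iterate 1, Or.inl (by rw [hk]; rfl)⟩, ?_, ?_, ?_, ?_, ?_⟩
  · rw [hk, markVal_i1, hm, if_neg hl]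
    norm_num
  · rw [hk, birkhoffSum_one, hg, coord1_i1 hw0 hw5, hz]
  · rw [hk, birkhoffSum_one, hg, if_neg hl, hm, markVal_i1, hc, coord2_i1]
    norm_num
  · intro h
    rw [hk] at h
    exact absurd (i1_snd w) h
  · intro _ _
    rw [hk, coord1_i1 hw0 hw5, hz, ← hb]
    exact branch_mono _ height_le

/-- Each good point has a step. The coordinates `0, 1, 2, 3`, where the letter is ambiguous, are
excluded because `f_t` maps those points to the vertex. -/
lemma exists_isStep {t : ℝ} (ht : t ∈ Icc (0 : ℝ) 1) {u : X} (hu : Good t u) :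
    ∃ k, IsStep t u k := by
  have hl := lc_bounds ht
  obtain ⟨ha, h | ⟨q, hq, rfl⟩⟩ := hu
  · obtain ⟨z, hz, rfl⟩ : ∃ z ∈ Ico (0 : ℝ) 5, i1 z = u := ⟨_, coord1_mem u, i1_coord1 u h⟩
    have hc := coord1_i1 hz.1 hz.2
    have hf := fT_i1 ht hz.1 hz.2
    have hg := gamma_i1_height ht hz.1 hz.2
    have hlt := letter_i1 hz.1 hz.2
    have ha0 := ha 0
    have ha1 := ha 1
    rw [Function.iterate_one, hf] at ha1
    have hz0 : 0 < z := hz.1.lt_of_ne (by rintro rfl; exact ha0 rfl)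
    by_cases h2 : z ≤ 2
    · rw [if_pos h2] at hf hg ha1
      have n2 : z ≠ 2 := by
        rintro rfl
        refine ha1 ?_
        rw [height, if_neg (by norm_num), if_pos le_rfl, sub_self, mul_zero, i2_zero]
      have n1 : z ≠ 1 := by
        rintro rfl
        refine ha1 ?_
        rw [height, if_pos le_rfl, mul_one, i2_three]
      have h2' := lt_of_le_of_ne h2 n2
      have hh : 0 < height t z ∧ height t z < 1 := by
        unfold height
        split_ifs with h1
        · exact ⟨hz0, lt_of_le_of_ne h1 n1⟩
        · constructor <;> linarith
      rw [if_pos h2'] at hlt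
      refine isStep_of_i2 ht ha hh.1 hh.2 hf ?_ ?_ ?_ ?_ (Or.inr hlt) ?_
      · rw [hg, hc]; simp
      · rw [hg, coord2_i1]; simp
      · rw [hlt, markVal_i1]; simp
      · rw [hlt]; decide
      · intro _; rw [hc]
    by_cases h3 : z ≤ 3
    · rw [if_neg h2, if_pos h3] at hf hg ha1
      have n3 : z ≠ 3 := by
        rintro rfl
        refine ha1 ?_
        rw [show (5 : ℝ) * (3 - 2) = 5 by norm_num, i1_five]
      have h3' := lt_of_le_of_ne h3 n3
      rw [if_neg (by linarith), if_pos h3'] at hlt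
      refine ⟨1, isStep_of_i1 ha rfl (by linarith) (by linarith) hf ?_ hc (by rw [hlt]; decide) ?_⟩
      · rw [hg, hlt]
        ext
        · simp
        · simp
      · rw [hlt, branch_one, height, if_neg (by linarith), if_neg h2, if_pos h3]
        ring
    · rw [if_neg h2, if_neg h3] at hf hg
      rw [if_neg (by linarith), if_neg (by linarith)] at hlt
      have hh : 3 ≤ height t z ∧ height t z < 4 := by
        rw [height, if_neg (by linarith), if_neg h2, if_neg h3]
        exact ⟨le_min (le_min (by linarith) (by linarith [hz.2])) (by linarith [hl.1]),
          (min_le_right _ _).trans_lt (by linarith [hl.2])⟩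
      refine ⟨1, isStep_of_i1 ha rfl (by linarith) (by linarith) hf ?_ hc (by rw [hlt]; decide) ?_⟩
      · rw [hg, hlt]
        ext
        · simp; ring
        · simp
      · rw [hlt, branch_two]
        ring
  · have h3 : q < 3 := by linarith [hq.2]
    have hlt := letter_i2 hq.1 h3
    have hs := i2_snd_ne hq.1 h3
    refine isStep_of_i2 ht ha hq.1 hq.2 ?_ ?_ ?_ ?_ ?_ (Or.inl hs) fun h => absurd h hs
    · rw [fT_i2 ht hq.1 h3, fTwo, if_pos hq.2.le]
    · rw [gamma_i2 t hq.1.le h3, e2, if_pos hq.2.le, coord1_i2]; simp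
    · rw [gamma_i2 t hq.1.le h3, e2, if_pos hq.2.le, coord2_i2 hq.1.le h3]; simp
    · rw [hlt, markVal_i2 hq.1 h3]; simp
    · rw [hlt]; decide

lemma markVal_mem (u : X) : 0 ≤ markVal u ∧ markVal u ≤ 1 := by
  unfold markVal
  split_ifs <;> norm_num

/-- The displacements along the orbit of a good point are, up to bounded errors, those of a sequence
of the `β`-shift. -/
lemma exists_coding_of_good {t : ℝ} (ht : t ∈ Icc (0 : ℝ) 1) {x : X} (hx : Good t x) :
    ∃ s ∈ betaShift (K (a t)), ∃ T : ℕ → ℕ,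
      (∀ i : ℕ, |(T i : ℝ) - (i + digitCount s 0 i)| ≤ 3) ∧
      (∀ i, |(birkhoffSum (fT t) (gamma t) (T i) x).1 - digitCount s 2 i| ≤ 3) ∧
      ∀ i, |(birkhoffSum (fT t) (gamma t) (T i) x).2 - digitCount s 0 i| ≤ 3 := by
  have hl := lc_bounds ht
  choose k hk using fun u : {u // Good t u} => exists_isStep ht u.2
  let next : {u // Good t u} → {u // Good t u} := fun u => ⟨(fT t)^[k u] u.1, (hk u).good⟩
  let u : ℕ → {u // Good t u} := fun i => next^[i] ⟨x, hx⟩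
  let T : ℕ → ℕ := fun i => ∑ j ∈ Finset.range i, k (u j)
  let e : Seq := fun i => letter (u i).1
  let A : ℕ → Prop := fun i => (u i).1.1.2 ≠ 0
  have hu : ∀ i, (u (i + 1)).1 = (fT t)^[k (u i)] (u i).1 := fun i =>
    congrArg Subtype.val (Function.iterate_succ_apply' next i _)
  have hstep := fun i => hk (u i)
  have hT : ∀ i, T (i + 1) = T i + k (u i) := fun i => Finset.sum_range_succ _ _
  have hT0 : T 0 = 0 := rfl
  have huT : ∀ i, (fT t)^[T i] x = (u i).1 := by
    intro i
    induction i with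
    | zero => rfl
    | succ i ih => rw [hT, add_comm, Function.iterate_add_apply, ih, hu]
  have inv : ∀ i, (T i : ℝ) = i + digitCount e 0 i + markVal x - markVal (u i).1 ∧
      (birkhoffSum (fT t) (gamma t) (T i) x).1 =
        digitCount e 2 i + coord1 (u i).1 / 5 - coord1 x / 5 ∧
      (birkhoffSum (fT t) (gamma t) (T i) x).2 = digitCount e 0 i + markVal x -
        markVal (u i).1 + coord2 (u i).1 / 3 - coord2 x / 3 := by
    intro i
    induction i with
    | zero =>
      have h0 : (u 0).1 = x := rfl
      rw [hT0, h0]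
      simp [digitCount_zero]
    | succ i ih =>
      obtain ⟨i1, i2, i3⟩ := ih
      have h1 := (hstep i).time
      have h2 := (hstep i).sum_fst
      have h3 := (hstep i).sum_snd
      rw [← hu] at h1 h2 h3
      rw [hT, birkhoffSum_add, huT, Prod.fst_add, Prod.snd_add, i2, i3, h2, h3, digitCount_succ,
        digitCount_succ]
      push_cast
      rw [i1, h1]
      refine ⟨?_, ?_, ?_⟩ <;> ring
  have hAe : ∀ i, A i → e i = 1 := fun i h => if_neg h
  have hA : ∀ i, A (i + 1) → A i ∨ e i = 0 := fun i h => (hstep i).mark (by rw [← hu]; exact h)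
  have htwo : ∀ i, e i = 2 → 3 ≤ height t (coord1 (u i).1) ∧ height t (coord1 (u i).1) ≤ lc t := by
    intro i h
    have hc := coord1_mem (u i).1
    have h' : 3 ≤ coord1 (u i).1 := by
      by_contra hlt
      simp only [e, letter] at h
      split_ifs at h <;> simp_all
    unfold height
    rw [if_neg (by linarith), if_neg (by linarith)]
    split_ifs
    · exact ⟨h', by linarith [hl.1]⟩
    · exact ⟨le_min (le_min h' (by linarith [hc.2])) (by linarith [hl.1]), min_le_right _ _⟩
  have hle := point_rearrange_le (e := e) (A := A) (y := fun i => height t (coord1 (u i).1))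
    hl.1 hAe hA (fun i => height_nonneg ht (coord1_mem _).1 (coord1_mem _).2)
    (fun i h h' => by
      have h1 := (hstep i).height (not_not.1 h)
      rw [← hu] at h1
      exact h1 (not_not.1 h'))
    (fun i h => (htwo i h).1) fun i h => (htwo i h).2
  have hcount := abs_digitCount_rearrange_sub_le (e := e) (A := A) hAe
  refine ⟨rearrange e A, mem_betaShift_of_point_le ht hle, T, fun i => ?_, fun i => ?_, fun i => ?_⟩
  · have h1 := abs_le.1 (hcount 0 i)
    have h2 := markVal_mem x
    have h3 := markVal_mem (u i).1
    rw [(inv i).1, abs_le]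
    constructor <;> linarith
  · have h1 := abs_le.1 (hcount 2 i)
    have h2 := coord1_mem x
    have h3 := coord1_mem (u i).1
    rw [(inv i).2.1, abs_le]
    constructor <;> linarith [h2.1, h2.2, h3.1, h3.2]
  · have h1 := abs_le.1 (hcount 0 i)
    have h2 := markVal_mem x
    have h3 := markVal_mem (u i).1
    have h4 := coord2_mem x
    have h5 := coord2_mem (u i).1
    rw [(inv i).2.2, abs_le]
    constructor <;> linarith [h4.1, h4.2, h5.1, h5.2]

lemma ones_mem_betaShift {t : ℝ} (ht : t ∈ Icc (0 : ℝ) 1) : ones ∈ betaShift (K (a t)) := by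
  refine mem_betaShift_of_point_le ht fun r => ?_
  have h : shift^[r] ones = ones := by
    funext n
    rw [shift_iterate]
    rfl
  rw [h, point_ones]
  linarith [(lc_bounds ht).1]

/-- The displacements along each orbit of `f_t` are, up to bounded errors, those of a sequence of
the `β`-shift. -/
lemma exists_coding {t : ℝ} (ht : t ∈ Icc (0 : ℝ) 1) (x : X) :
    ∃ s ∈ betaShift (K (a t)), ∃ (T : ℕ → ℕ) (C : ℝ),
      (∀ i : ℕ, |(T i : ℝ) - (i + digitCount s 0 i)| ≤ C) ∧
      (∀ i, |(birkhoffSum (fT t) (gamma t) (T i) x).1 - digitCount s 2 i| ≤ C) ∧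
      ∀ i, |(birkhoffSum (fT t) (gamma t) (T i) x).2 - digitCount s 0 i| ≤ C := by
  by_cases ha : AvoidsVertex t x
  · by_cases hx : Good t x
    · obtain ⟨s, hs, T, h⟩ := exists_coding_of_good ht hx
      exact ⟨s, hs, T, 3, h⟩
    -- A point of `B` or `b` is good after one step.
    · have h2 : x.1.2 ≠ 0 := fun h => hx ⟨ha, Or.inl h⟩
      obtain ⟨q, hq, rfl⟩ : ∃ q ∈ Ico (0 : ℝ) 3, i2 q = x :=
        ⟨_, coord2_mem x, i2_coord2 x (x.2.resolve_right h2)⟩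
      have hq0 : 0 < q := hq.1.lt_of_ne (by rintro rfl; exact ha 0 i2_zero)
      have h1 : 1 ≤ q := by
        by_contra h
        exact hx ⟨ha, Or.inr ⟨q, ⟨hq0, not_le.1 h⟩, rfl⟩⟩
      obtain ⟨z, -, hz, -, -⟩ := fT_i2_of_one_le ht h1 hq.2 ha
      have hgood : Good t (fT t (i2 q)) := ⟨ha.iterate 1, Or.inl (by rw [hz]; rfl)⟩
      obtain ⟨s, hs, T, g1, g2, g3⟩ := exists_coding_of_good ht hgood
      set c := gamma t (i2 q)
      have hsum : ∀ i, birkhoffSum (fT t) (gamma t) (T i + 1) (i2 q) =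
          c + birkhoffSum (fT t) (gamma t) (T i) (fT t (i2 q)) := fun i =>
        birkhoffSum_succ' _ _ _ _
      have hc1 := abs_nonneg c.1
      have hc2 := abs_nonneg c.2
      refine ⟨s, hs, fun i => T i + 1, 4 + |c.1| + |c.2|, fun i => ?_, fun i => ?_, fun i => ?_⟩
      · have := abs_le.1 (g1 i)
        rw [abs_le]
        push_cast
        constructor <;> linarith
      · rw [hsum, Prod.fst_add, add_sub_assoc]
        linarith [abs_add_le c.1 ((birkhoffSum (fT t) (gamma t) (T i) (fT t (i2 q))).1 -
          digitCount s 2 i), g2 i]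
      · rw [hsum, Prod.snd_add, add_sub_assoc]
        linarith [abs_add_le c.2 ((birkhoffSum (fT t) (gamma t) (T i) (fT t (i2 q))).2 -
          digitCount s 0 i), g3 i]
  -- An orbit that reaches the vertex stays there, and has the displacements of `1^∞`.
  · obtain ⟨n, hn⟩ : ∃ n, (fT t)^[n] x = i1 0 := by simpa [AvoidsVertex] using ha
    have hfix : fT t (i1 0) = i1 0 := by
      rw [fT_i1 ht le_rfl (by norm_num), if_pos (by norm_num), height, if_pos (by norm_num),
        mul_zero, i2_zero]
    have hg : gamma t (i1 0) = 0 := by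
      rw [gamma_i1 t le_rfl (by norm_num), e1_zero]
      simp
    have hsum : ∀ i, birkhoffSum (fT t) (gamma t) (n + i) x =
        birkhoffSum (fT t) (gamma t) n x := by
      intro i
      rw [birkhoffSum_add, hn, add_eq_left]
      exact Finset.sum_eq_zero fun j _ => by rw [Function.iterate_fixed hfix, hg]
    set c := birkhoffSum (fT t) (gamma t) n x
    have h0 : ∀ i, digitCount ones 0 i = 0 := fun i => by simp [digitCount, ones]
    have h2 : ∀ i, digitCount ones 2 i = 0 := fun i => by simp [digitCount, ones]
    have hc1 := abs_nonneg c.1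
    have hc2 := abs_nonneg c.2
    have hn0 : (0 : ℝ) ≤ n := n.cast_nonneg
    refine ⟨ones, ones_mem_betaShift ht, fun i => n + i, n + |c.1| + |c.2|, fun i => ?_,
      fun i => ?_, fun i => ?_⟩
    · rw [h0]
      push_cast
      rw [add_zero, add_sub_cancel_right, abs_of_nonneg hn0]
      linarith
    · rw [hsum, h2, sub_zero]
      linarith
    · rw [hsum, h0, sub_zero]
      linarith

lemma rho8_eq {t : ℝ} (ht : t ∈ Icc (0 : ℝ) 1) : rho8 t = PiMap '' DF (K (a t)) := by
  apply Subset.antisymm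
  · rintro v ⟨x, -, hv⟩
    obtain ⟨s, hs, T, C, h1, h2, h3⟩ := exists_coding ht x
    obtain ⟨α, hα, rfl⟩ := tendsto_frequency_of_displacement hv h1 h2 h3
    exact ⟨α, ⟨s, hs, hα⟩, rfl⟩
  · rintro _ ⟨α, ⟨s, hs, hα⟩, rfl⟩
    exact piMap_mem_rho8 ht (fun r => (mem_betaShift_iff.1 hs r).trans (point_K_a_mem ht).2) hα

end FigureEight

theorem theorem4p2 (t : ℝ) (ht : t ∈ Set.Icc (0 : ℝ) 1) :
    IsGreatest {t' | t' ∈ FigureEight.paramSet ∧ t' ≤ t} (FigureEight.a t) ∧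
      FigureEight.rho8 t =
        FigureEight.PiMap '' FigureEight.DF (FigureEight.K (FigureEight.a t)) :=
  ⟨FigureEight.isGreatest_a ht, FigureEight.rho8_eq ht⟩
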